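/- Let $\mathbb H$ be the upper half plane, $q=e^{\pi i\tau}$ for $\tau\in\mathbb H$, $\theta(\tau)=\big(\sum_{n\in\mathbb Z}q^{n^2}\big)^2$, and let $l=\lambda/16=q-8q^2+44q^3-192q^4+\cdots$ be the normalized elliptic modular lambda function, where $\lambda(\tau)=\big(\sum_{n\in\mathbb Z}e^{\pi i(n+1/2)^2\tau}\big)^4\big/\big(\sum_{n\in\mathbb Z}e^{\pi i n^2\tau}\big)^4$. Let $\Delta\subset\mathrm{SL}_2(\mathbb Z)$ be the subgroup generated by $\begin{pmatrix}1&2\\0&1\end{pmatrix}$ and $\begin{pmatrix}1&0\\2&1\end{pmatrix}$, and let $S_5(\Delta)$ be the space of cusp forms of weight $5$ for $\Delta$. All Fourier coefficients below are integers. (a) The function $f_1=l(1-16l)\theta^5=\sum_{n\ge1}b_1(n)q^n$ is the cusp form in $S_5(\Delta)$ with complex multiplication by $\mathbb Q(i)$, i.e. it lies in $S_5(\Delta)$ and is the only element of $S_5(\Delta)$ of the form $\sum_{\mathfrak a}\psi(\mathfrak a)q^{N\mathfrak a}$ for a Hecke character $\psi$ of $\mathbb Q(i)$ of infinity type $4$,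 i.e. $\psi((\alpha))=\alpha^4$ for all nonzero $\alpha\in\mathbb Z[i]$ congruent to $1$ modulo the modulus of $\psi$; the sum is over the nonzero ideals of $\mathbb Z[i]$, and $\psi$ is extended by $0$ to the ideals not prime to the modulus. In particular, for every prime $p>2$: if $p\equiv1\pmod 4$ and $p=x^2+y^2$ with $x,y\in\mathbb Z$, then $b_1(p)=2x^4-12x^2y^2+2y^4$; if $p\equiv3\pmod4$, then $b_1(p)=0$. (b) The function $g_1=l^2(1-16l)^2\theta^5=\sum_{n\ge2}c_1(n)q^n$ is a weakly holomorphic modular form of weight $5$ for $\Delta$, and for every integer $n>2$ $$b_1(n)\equiv108\,c_1(n)\pmod{n^3}.$$ (c) For every integer $n>1$ let $f_n=\theta^{6n-6}(1-16l)^{\lfloor (n-1)/2\rfloor}\,l^{2n-2}f_1=\sum_{m\ge1}b_n(m)q^m$. Then $b_n(p)=0$ for every prime $p\equiv(-1)^n\pmod 4$. -/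

import Mathlib

open Complex
open UpperHalfPlane hiding I
open scoped MatrixGroups ModularForm Manifold

noncomputable section

namespace LambdaForms

/-- The subgroup `Δ` of `SL₂(ℤ)` generated by `(1 2; 0 1)` and `(1 0; 2 1)`. -/
def Delta : Subgroup SL(2, ℤ) :=
  Subgroup.closure {⟨!![1, 2; 0, 1], by simp [Matrix.det_fin_two]⟩,
    ⟨!![1, 0; 2, 1], by simp [Matrix.det_fin_two]⟩}

/-- The nome `q = exp(π i τ)`. -/
def nome (τ : ℍ) : ℂ := cexp (Real.pi * I * τ)

/-- The Jacobi theta constant `θ₂(τ) = ∑_{n ∈ ℤ} exp(π i (n + 1/2)² τ)`. -/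
def thetaTwo (τ : ℍ) : ℂ := ∑' n : ℤ, cexp (Real.pi * I * ((n : ℂ) + 1 / 2) ^ 2 * τ)

/-- The Jacobi theta constant `θ₃(τ) = ∑_{n ∈ ℤ} q^{n²}`. -/
def thetaThree (τ : ℍ) : ℂ := ∑' n : ℤ, cexp (Real.pi * I * (n : ℂ) ^ 2 * τ)

/-- The weight one theta series `θ(τ) = (∑_{n ∈ ℤ} q^{n²})²`. -/
def theta (τ : ℍ) : ℂ := thetaThree τ ^ 2

/-- The elliptic modular lambda function `λ = θ₂⁴ / θ₃⁴`. -/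
def modularLambda (τ : ℍ) : ℂ := thetaTwo τ ^ 4 / thetaThree τ ^ 4

/-- The normalized elliptic modular lambda function `l = λ / 16 = q - 8 q² + 44 q³ - ⋯`. -/
def ell (τ : ℍ) : ℂ := modularLambda τ / 16

/-- `f₁ = l (1 - 16 l) θ⁵`. -/
def f₁ (τ : ℍ) : ℂ := ell τ * (1 - 16 * ell τ) * theta τ ^ 5

/-- `g₁ = l² (1 - 16 l)² θ⁵`. -/
def g₁ (τ : ℍ) : ℂ := ell τ ^ 2 * (1 - 16 * ell τ) ^ 2 * theta τ ^ 5

/-- `fₙ = θ^(6n-6) (1 - 16 l)^⌊(n-1)/2⌋ l^(2n-2) f₁`, used for `n ≥ 1` only. -/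
def fSeq (n : ℕ) (τ : ℍ) : ℂ :=
  theta τ ^ (6 * n - 6) * (1 - 16 * ell τ) ^ ((n - 1) / 2) * ell τ ^ (2 * n - 2) * f₁ τ

/-- `F(τ) = ∑_{n ≥ 0} a(n) qⁿ` on the whole upper half plane, `q = exp(π i τ)`. -/
def HasFourierExpansion (F : ℍ → ℂ) (a : ℕ → ℤ) : Prop :=
  ∀ τ : ℍ, HasSum (fun n : ℕ => (a n : ℂ) * nome τ ^ n) (F τ)

/-- Weakly holomorphic modular forms of weight `k` for a finite index subgroup `Γ` of `SL₂(ℤ)`: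
holomorphic on the upper half plane, invariant under the weight `k` slash action of `Γ`, and
meromorphic at every cusp (after translating the cusp to `i∞`, multiplication by a power of
`exp(2 π i τ)` gives a function bounded at `i∞`). -/
structure IsWeaklyHolomorphic (Γ : Subgroup SL(2, ℤ)) (k : ℤ) (F : ℍ → ℂ) : Prop where
  holo : MDiff F
  slash_eq : ∀ γ ∈ Γ, F ∣[k] γ = F
  meromorphic_at_cusps : ∀ γ : SL(2, ℤ), ∃ N : ℕ,
    IsBoundedAtImInfty (fun τ : ℍ => cexp (2 * Real.pi * I * τ) ^ N * (F ∣[k] γ) τ)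

/-- `ψ` is a Hecke character of `ℚ(i)` of infinity type `w` and modulus `𝔪`, as a multiplicative
function on the ideals of the ring of integers `ℤ[i]`: it vanishes on the ideals that are not
prime to `𝔪`, and `ψ((α)) = α ^ w` whenever `α ≡ 1 mod 𝔪`. (That `ψ` does not vanish on the
ideals prime to `𝔪` follows.) -/
structure IsHeckeCharacter (w : ℕ) (𝔪 : Ideal GaussianInt) (ψ : Ideal GaussianInt →*₀ ℂ) :
    Prop where
  modulus_ne_bot : 𝔪 ≠ ⊥
  eq_zero : ∀ J : Ideal GaussianInt, ¬ IsCoprime J 𝔪 → ψ J = 0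
  principal : ∀ α : GaussianInt, α ≠ 0 → α - 1 ∈ 𝔪 →
    ψ (Ideal.span {α}) = GaussianInt.toComplex α ^ w

/-- `F` is the (normalized) form of weight `k` with complex multiplication by `ℚ(i)` attached to
some Hecke character `ψ` of `ℚ(i)` of infinity type `k - 1`, that is
`F = ∑_𝔞 ψ(𝔞) q^{N 𝔞}`, the sum being over the ideals of `ℤ[i]`
(the zero ideal contributes `0`). -/
def HasCMByQi (k : ℕ) (F : ℍ → ℂ) : Prop :=
  ∃ (𝔪 : Ideal GaussianInt) (ψ : Ideal GaussianInt →*₀ ℂ), IsHeckeCharacter (k - 1) 𝔪 ψ ∧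
    ∀ τ : ℍ, HasSum
      (fun J : Ideal GaussianInt => ψ J * nome τ ^ Nat.card (GaussianInt ⧸ J)) (F τ)

end LambdaForms

end

open LambdaForms

/-!
Everything is expressed through the theta constants `θ₂, θ₃, θ₄`: since `1 - 16 l = θ₄⁴ / θ₃⁴`,
`f₁ = θ₂⁴ θ₃² θ₄⁴ / 16` and `g₁ = θ₂⁸ θ₃⁻⁶ θ₄⁸ / 256`. The weight one action of `SL₂(ℤ)` permutes
the squares of the theta constants up to constants, which gives the modularity of both forms and
their orders at all cusps (`exists_thetaMono_slash`). As `f₁` has no zeros on the upper half plane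
and vanishes at each cusp to the smallest order that a cusp form of weight `5` can have, the
quotient of any such form by `f₁` is a modular form of weight `0`, hence constant
(`exists_eq_smul_f₁`). A form `∑ ψ(𝔞) q^{N 𝔞}` has first coefficient `1`, so `f₁` is the only one
that can be of this shape.

The identities between expansions are formal. As power series in `q`, the functions `φ = θ₃`,
`v = θ₄` and `ψ = θ₂ / (2 q^{1/4})` satisfy Landen's relations between `τ` and `2 τ`
(`IsLandenTriple`). A power series `A` with `A(q) = r A(q²)` is constant; applied to combinations
of logarithmic derivatives, this yields the expressions of the differences of `D θᵢ / θᵢ` as fourth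
powers of theta constants, and Ramanujan-type differential equations, where `D = q d/dq`. From
these follow:

* `2 θ₃ D² θ₃ - 6 (D θ₃)² = 4 f₁` (`IsLandenTriple.rankinCohen_phi`). The left side is the theta
  series `∑ α⁴ q^{N α}` over the Gaussian integers, so that `f₁` is the series attached to the
  Hecke character `(α) ↦ α⁴` of conductor `1` (`hasSum_heckeChar`).
* `D⁴ (θ₃⁻⁶) = -12 f₁ + 1296 g₁` (`IsLandenTriple.eulerD_four_inv_phi_pow`). As `θ₃ ≡ 1` modulo
  `2`, the coefficients of `D (θ₃⁻⁶)` are divisible by `12`, so that the coefficient of `qⁿ` in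
  `D⁴ (θ₃⁻⁶)` is divisible by `12 n³`, which is the congruence (`modEq_of_coeff`).

Finally `fₙ` is again a product of powers of `q`, `φ`, `v` and `ψ`. By Landen's relations it is
`q^{2n-1}` times a power series in `q²` times `v²` or `φ²`, according to the parity of `n`, and
`v² = φ(q²)² - 4 q ψ(q²)²`, `φ² = φ(q²)² + 4 q ψ(q²)²` split it into a part whose exponents are all
congruent to `2n - 1` modulo `4` and a part with even exponents (`coeff_fSeq_odd_eq_zero`,
`coeff_fSeq_even_eq_zero`).
-/

open LambdaForms

/-! ### The Euler operator and Landen triples of power series -/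

open PowerSeries in
/-- The Euler operator `X d/dX` on formal power series. -/
noncomputable def eulerD {K : Type*} [CommRing K] : Derivation K K⟦X⟧ K⟦X⟧ :=
  (X : K⟦X⟧) • d⁄dX K

section Formal

open PowerSeries

variable {K : Type*} [Field K]

instance charZero_powerSeries {R : Type*} [CommRing R] [CharZero R] : CharZero R⟦X⟧ :=
  ⟨fun m n h => by simpa using congrArg constantCoeff h⟩

theorem coeff_eulerD {R : Type*} [CommRing R] (A : R⟦X⟧) (n : ℕ) :
    coeff n (eulerD A) = n * coeff n A := by
  cases n with
  | zero => simp [eulerD]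
  | succ n => simp [eulerD, coeff_succ_X_mul, coeff_derivative, mul_comm]

theorem eulerD_X {R : Type*} [CommRing R] : eulerD (X : R⟦X⟧) = X := by
  simp [eulerD]

/-- The substitution `X ↦ X ^ 2`, the formal counterpart of `τ ↦ 2 τ`. -/
noncomputable abbrev dbl {R : Type*} [CommRing R] : R⟦X⟧ →ₐ[R] R⟦X⟧ :=
  expand 2 two_ne_zero

theorem eulerD_dbl {R : Type*} [CommRing R] (A : R⟦X⟧) :
    eulerD (dbl A) = 2 * dbl (eulerD A) := by
  ext n
  have h2 : (2 : R⟦X⟧) = C (2 : R) := (map_ofNat C 2).symm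
  rw [coeff_eulerD, h2, coeff_C_mul, coeff_expand, coeff_expand]
  split_ifs with h
  · obtain ⟨m, rfl⟩ := h
    rw [Nat.mul_div_cancel_left _ two_pos, coeff_eulerD]
    push_cast; ring
  · simp

/-- A power series that is a multiple of its own image under `X ↦ X ^ 2` is constant. -/
theorem eq_C_of_eq_C_mul_dbl {R : Type*} [CommRing R] {A : R⟦X⟧} (r : R)
    (h : A = C r * dbl A) : A = C (constantCoeff A) := by
  have key : ∀ n : ℕ, 0 < n → coeff n A = 0 := by
    intro n
    induction n using Nat.strong_induction_on with
    | _ n ih =>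
      intro hn
      rw [h, coeff_C_mul, coeff_expand]
      split_ifs with hd
      · rw [ih (n / 2) (by omega) (by omega), mul_zero]
      · exact mul_zero _
  ext n
  rcases Nat.eq_zero_or_pos n with rfl | hn
  · simp
  · rw [key n hn, coeff_C, if_neg hn.ne']

/-- The logarithmic derivative `D A / A` of a power series over a field. -/
noncomputable def logD (A : K⟦X⟧) : K⟦X⟧ := eulerD A * A⁻¹

theorem eulerD_eq_logD_mul {A : K⟦X⟧} (hA : constantCoeff A ≠ 0) : eulerD A = logD A * A := by
  rw [logD, mul_assoc, PowerSeries.inv_mul_cancel _ hA, mul_one]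

/-- Three power series subject to Landen's transformation, with constant term `1`: the formal
properties of `φ = θ₃`, `v = θ₄` and `ψ = θ₂ / (2 q ^ (1/4))`. -/
structure IsLandenTriple (φ v ψ : K⟦X⟧) : Prop where
  const_phi : constantCoeff φ = 1
  const_v : constantCoeff v = 1
  const_psi : constantCoeff ψ = 1
  phi_sq : φ ^ 2 = dbl φ ^ 2 + 4 * X * dbl ψ ^ 2
  v_sq : v ^ 2 = dbl φ ^ 2 - 4 * X * dbl ψ ^ 2
  psi_sq : ψ ^ 2 = dbl φ * dbl ψ
  phi_mul_v : φ * v = dbl v ^ 2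

namespace IsLandenTriple

variable {φ v ψ : K⟦X⟧} (h : IsLandenTriple φ v ψ)
include h

theorem phi_ne : φ ≠ 0 := by
  rintro rfl; simpa using h.const_phi

theorem v_ne : v ≠ 0 := by
  rintro rfl; simpa using h.const_v

theorem psi_ne : ψ ≠ 0 := by
  rintro rfl; simpa using h.const_psi

/-- Jacobi's identity `θ₃⁴ - θ₄⁴ = θ₂⁴`. -/
theorem jacobi : φ ^ 4 - v ^ 4 = 16 * X * ψ ^ 4 := by
  linear_combination (φ ^ 2 + dbl φ ^ 2 + 4 * X * dbl ψ ^ 2) * h.phi_sq -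
    (v ^ 2 + dbl φ ^ 2 - 4 * X * dbl ψ ^ 2) * h.v_sq -
    16 * X * (ψ ^ 2 + dbl φ * dbl ψ) * h.psi_sq

theorem D_phi : eulerD φ = logD φ * φ := eulerD_eq_logD_mul (by simp [h.const_phi])
theorem D_v : eulerD v = logD v * v := eulerD_eq_logD_mul (by simp [h.const_v])
theorem D_psi : eulerD ψ = logD ψ * ψ := eulerD_eq_logD_mul (by simp [h.const_psi])

/-- The logarithmic derivative of `θ₂ = 2 q ^ (1/4) ψ`, where the factor `q ^ (1/4)`, which is not a
power series, contributes the constant `1 / 4`. -/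
noncomputable def logDTwo (ψ : K⟦X⟧) : K⟦X⟧ := C (1 / 4) + logD ψ

variable [CharZero K]

omit h in
theorem four_mul_logDTwo : 4 * logDTwo ψ = 1 + 4 * logD ψ := by
  have : (4 : K⟦X⟧) * C (1 / 4 : K) = 1 := by
    rw [← map_ofNat C 4, ← map_mul]; simp
  rw [logDTwo, mul_add, this]

omit h in
theorem four_mul_dbl_logDTwo : 4 * dbl (logDTwo ψ) = 1 + 4 * dbl (logD ψ) := by
  simpa [map_ofNat dbl 4] using congrArg dbl (four_mul_logDTwo (ψ := ψ))

theorem logDTwo_eq : logDTwo ψ = dbl (logDTwo ψ) + dbl (logD φ) := by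
  have e := congrArg eulerD h.psi_sq
  simp only [pow_two, Derivation.leibniz, eulerD_dbl, smul_eq_mul, h.D_phi, h.D_psi, map_mul] at e
  have hψ : (8 : K⟦X⟧) * ψ ^ 2 ≠ 0 := mul_ne_zero (by norm_num) (pow_ne_zero 2 h.psi_ne)
  refine mul_left_cancel₀ hψ ?_
  linear_combination 2 * ψ ^ 2 * four_mul_logDTwo (ψ := ψ) + 4 * e -
    2 * ψ ^ 2 * four_mul_dbl_logDTwo (ψ := ψ) -
    8 * (dbl (logD ψ) + dbl (logD φ)) * h.psi_sq

omit [CharZero K] in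
theorem logD_phi_add_logD_v : logD φ + logD v = 4 * dbl (logD v) := by
  have e := congrArg eulerD h.phi_mul_v
  simp only [pow_two, Derivation.leibniz, eulerD_dbl, smul_eq_mul, h.D_phi, h.D_v, map_mul] at e
  refine mul_left_cancel₀ (mul_ne_zero h.phi_ne h.v_ne) ?_
  linear_combination e - 4 * dbl (logD v) * h.phi_mul_v

theorem logD_phi_mul_sq : logD φ * φ ^ 2 =
    2 * (dbl φ ^ 2 * dbl (logD φ) + 4 * X * dbl ψ ^ 2 * dbl (logDTwo ψ)) := by
  have h4 : eulerD (4 : K⟦X⟧) = 0 := by simpa using (eulerD (K := K)).map_natCast (n := 4)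
  have e := congrArg eulerD h.phi_sq
  simp only [pow_two, Derivation.leibniz, eulerD_dbl, smul_eq_mul, h.D_phi, h.D_psi, map_mul,
    map_add, eulerD_X, h4] at e
  refine mul_left_cancel₀ (two_ne_zero (α := K⟦X⟧)) ?_
  linear_combination e - 4 * X * dbl ψ ^ 2 * four_mul_dbl_logDTwo (ψ := ψ)

/-- The logarithmic derivative of `θ₂ / θ₃` is `θ₄⁴ / 4`: the quotient of the two sides is
invariant under `X ↦ X ^ 2` by Landen's transformation, hence constant. -/
theorem logDTwo_sub_logD_phi : 4 * (logDTwo ψ - logD φ) = v ^ 4 := by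
  have hv : constantCoeff (v ^ 4) ≠ 0 := by simp [h.const_v]
  set R : K⟦X⟧ := 4 * (logDTwo ψ - logD φ) * (v ^ 4)⁻¹ with hR
  have hRv : R * v ^ 4 = 4 * (logDTwo ψ - logD φ) := by
    rw [hR, mul_assoc, PowerSeries.inv_mul_cancel _ hv, mul_one]
  have hRE : dbl R * dbl v ^ 4 = 4 * (dbl (logDTwo ψ) - dbl (logD φ)) := by
    simpa [map_ofNat dbl 4] using congrArg dbl hRv
  have step : R = C 1 * dbl R := by
    have h1 : φ ^ 2 * v ^ 4 ≠ 0 := mul_ne_zero (pow_ne_zero _ h.phi_ne) (pow_ne_zero _ h.v_ne)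
    refine mul_left_cancel₀ h1 ?_
    rw [map_one, one_mul]
    linear_combination φ ^ 2 * hRv - v ^ 2 * hRE + 4 * φ ^ 2 * h.logDTwo_eq
      - 4 * h.logD_phi_mul_sq + 4 * (dbl (logDTwo ψ) + dbl (logD φ)) * h.phi_sq
      - 4 * (dbl (logDTwo ψ) - dbl (logD φ)) * h.v_sq
      - v ^ 2 * dbl R * (φ * v + dbl v ^ 2) * h.phi_mul_v
  have hc : constantCoeff R = 1 := by
    simp [hR, h.const_v, logDTwo, logD, eulerD, map_ofNat (constantCoeff (R := K)) 4]
  have := eq_C_of_eq_C_mul_dbl 1 step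
  rw [hc, map_one] at this
  rw [← hRv, this, one_mul]

theorem logDTwo_sub_logD_v : 4 * (logDTwo ψ - logD v) = φ ^ 4 := by
  have h16 : eulerD (16 : K⟦X⟧) = 0 := by simpa using (eulerD (K := K)).map_natCast (n := 16)
  have e := congrArg eulerD h.jacobi
  simp only [Derivation.leibniz, Derivation.leibniz_pow, smul_eq_mul, nsmul_eq_mul, h.D_phi, h.D_v,
    h.D_psi, map_sub, eulerD_X, h16] at e
  refine mul_left_cancel₀ (pow_ne_zero 4 h.v_ne) ?_
  have h2 := h.logDTwo_sub_logD_phi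
  push_cast at e
  linear_combination e + φ ^ 4 * h2 - 4 * X * ψ ^ 4 * 4 * four_mul_logDTwo (ψ := ψ) -
    4 * logDTwo ψ * h.jacobi

theorem logD_phi_sub_logD_v : logD φ - logD v = 4 * X * ψ ^ 4 := by
  refine mul_left_cancel₀ (by norm_num : (4 : K⟦X⟧) ≠ 0) ?_
  linear_combination h.logDTwo_sub_logD_v - h.logDTwo_sub_logD_phi + h.jacobi

theorem eulerD_logDTwo_sub_phi :
    eulerD (logDTwo ψ) - eulerD (logD φ) = 4 * logD v * (logDTwo ψ - logD φ) := by
  have h4 : eulerD (4 : K⟦X⟧) = 0 := by simpa using (eulerD (K := K)).map_natCast (n := 4)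
  have e := congrArg eulerD h.logDTwo_sub_logD_phi
  simp only [Derivation.leibniz, Derivation.leibniz_pow, smul_eq_mul, nsmul_eq_mul, h.D_v, map_sub,
    h4] at e
  refine mul_left_cancel₀ (by norm_num : (4 : K⟦X⟧) ≠ 0) ?_
  push_cast at e
  linear_combination e - 4 * logD v * h.logDTwo_sub_logD_phi

theorem eulerD_logDTwo_sub_v :
    eulerD (logDTwo ψ) - eulerD (logD v) = 4 * logD φ * (logDTwo ψ - logD v) := by
  have h4 : eulerD (4 : K⟦X⟧) = 0 := by simpa using (eulerD (K := K)).map_natCast (n := 4)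
  have e := congrArg eulerD h.logDTwo_sub_logD_v
  simp only [Derivation.leibniz, Derivation.leibniz_pow, smul_eq_mul, nsmul_eq_mul, h.D_phi,
    map_sub, h4] at e
  refine mul_left_cancel₀ (by norm_num : (4 : K⟦X⟧) ≠ 0) ?_
  push_cast at e
  linear_combination e - 4 * logD φ * h.logDTwo_sub_logD_v

/-- Halphen's differential equation for the logarithmic derivatives of the theta constants. The
difference `Y` of the two sides satisfies `Y(X) = 4 Y(X ^ 2)` by Landen's transformation, and has
no constant term. -/
theorem eulerD_logD_phi : eulerD (logD φ) =
    2 * (logDTwo ψ * logD φ + logD φ * logD v - logDTwo ψ * logD v) := by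
  set a := logDTwo ψ with ha
  set b := logD φ with hb
  set c := logD v with hc
  set Y : K⟦X⟧ := eulerD b - 2 * (a * b + b * c - a * c) with hY
  have hab := h.eulerD_logDTwo_sub_phi
  rw [← ha, ← hb, ← hc] at hab
  have hYE : dbl Y = dbl (eulerD b) - 2 * (dbl a * dbl b + dbl b * dbl c - dbl a * dbl c) := by
    simp [hY, map_ofNat dbl 2]
  have habE : dbl (eulerD a) - dbl (eulerD b) = 4 * dbl c * (dbl a - dbl b) := by
    simpa [map_ofNat dbl 4] using congrArg dbl hab
  have hDa : eulerD a = 2 * dbl (eulerD a) + 2 * dbl (eulerD b) := by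
    have := congrArg eulerD h.logDTwo_eq
    simpa [eulerD_dbl] using this
  have ha' : a = dbl a + dbl b := h.logDTwo_eq
  have hbc : b + c = 4 * dbl c := h.logD_phi_add_logD_v
  have hac4 : 4 * (dbl a - dbl c) = dbl φ ^ 4 := by
    simpa [map_ofNat dbl 4] using congrArg dbl h.logDTwo_sub_logD_v
  have hbc4 : dbl b - dbl c = 4 * X ^ 2 * dbl ψ ^ 4 := by
    simpa [map_ofNat dbl 4] using congrArg dbl h.logD_phi_sub_logD_v
  have hsub : b - c = 4 * X * ψ ^ 4 := h.logD_phi_sub_logD_v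
  have hsq : (b - c) ^ 2 = 16 * (dbl a - dbl c) * (dbl b - dbl c) := by
    linear_combination (b - c + 4 * X * ψ ^ 4) * hsub - 4 * (dbl b - dbl c) * hac4 -
      4 * dbl φ ^ 4 * hbc4 + 16 * X ^ 2 *
        (ψ ^ 6 + ψ ^ 4 * dbl φ * dbl ψ + ψ ^ 2 * (dbl φ * dbl ψ) ^ 2 + (dbl φ * dbl ψ) ^ 3) *
        h.psi_sq
  have step : Y = C 4 * dbl Y := by
    rw [map_ofNat]
    refine mul_left_cancel₀ (two_ne_zero (α := K⟦X⟧)) ?_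
    linear_combination 2 * hY - 8 * hYE - 2 * hab + 2 * hDa - 4 * (b + c) * ha' -
      4 * (dbl a + dbl b) * hbc + (b + c + 4 * dbl c) * hbc - hsq + 4 * habE
  have h0 : constantCoeff Y = 0 := by
    simp [hY, ha, hb, hc, logDTwo, logD, eulerD]
  have := eq_C_of_eq_C_mul_dbl 4 step
  rw [h0, map_zero] at this
  exact sub_eq_zero.mp this

theorem eulerD_logDTwo : eulerD (logDTwo ψ) =
    2 * (logDTwo ψ * logD φ + logDTwo ψ * logD v - logD φ * logD v) := by
  linear_combination h.eulerD_logDTwo_sub_phi + h.eulerD_logD_phi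

theorem eulerD_logD_v : eulerD (logD v) =
    2 * (logDTwo ψ * logD v + logD φ * logD v - logDTwo ψ * logD φ) := by
  linear_combination h.eulerD_logDTwo - h.eulerD_logDTwo_sub_v

/-- The theta series of the harmonic polynomial `Re (m + i n) ^ 4`, which is a Rankin-Cohen bracket
of `θ₃` with itself, is the product `θ₂⁴ θ₃² θ₄⁴ / 4`. -/
theorem rankinCohen_phi :
    2 * φ * eulerD (eulerD φ) - 6 * eulerD φ ^ 2 = 4 * (X * ψ ^ 4 * φ ^ 2 * v ^ 4) := by
  have e : eulerD (eulerD φ) = (eulerD (logD φ) + logD φ ^ 2) * φ := by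
    conv_lhs => rw [h.D_phi]
    rw [Derivation.leibniz, h.D_phi, smul_eq_mul, smul_eq_mul]; ring
  rw [e, h.D_phi, h.eulerD_logD_phi]
  linear_combination φ ^ 2 * (logD φ - logD v) * h.logDTwo_sub_logD_phi +
    φ ^ 2 * v ^ 4 * h.logD_phi_sub_logD_v

omit [CharZero K] in
theorem eulerD_inv_phi_pow : eulerD (φ⁻¹ ^ 6) = -6 * logD φ * φ⁻¹ ^ 6 := by
  have h1 : φ * φ⁻¹ = 1 := PowerSeries.mul_inv_cancel _ (by simp [h.const_phi])
  have e := congrArg eulerD h1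
  simp only [Derivation.leibniz, smul_eq_mul, h.D_phi, Derivation.map_one_eq_zero] at e
  have e2 : eulerD φ⁻¹ = -logD φ * φ⁻¹ := by
    refine mul_left_cancel₀ h.phi_ne ?_
    linear_combination e
  rw [Derivation.leibniz_pow, e2, nsmul_eq_mul, smul_eq_mul]
  push_cast
  ring

/-- The Eichler integral behind the congruence: `D⁴ (θ₃ ^ (-6))` is a combination of
`f₁ = θ₂⁴ θ₃² θ₄⁴ / 16` and `g₁ = θ₂⁸ θ₃ ^ (-6) θ₄⁸ / 256`. With the differential equations for the
logarithmic derivatives of the theta constants, both sides are `θ₃ ^ (-6)` times a polynomial in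
these. -/
theorem eulerD_four_inv_phi_pow :
    eulerD (eulerD (eulerD (eulerD (φ⁻¹ ^ 6)))) =
      -12 * (X * ψ ^ 4 * φ ^ 2 * v ^ 4) + 1296 * (X ^ 2 * ψ ^ 8 * v ^ 8 * φ⁻¹ ^ 6) := by
  have h1 : φ * φ⁻¹ = 1 := PowerSeries.mul_inv_cancel _ (by simp [h.const_phi])
  have hφ2 : φ ^ 2 = φ⁻¹ ^ 6 * φ ^ 8 := by
    linear_combination -φ ^ 2 * (1 + φ * φ⁻¹ + (φ * φ⁻¹) ^ 2 + (φ * φ⁻¹) ^ 3 + (φ * φ⁻¹) ^ 4 +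
      (φ * φ⁻¹) ^ 5) * h1
  have hu := h.eulerD_inv_phi_pow
  have hw : 4 * (X * ψ ^ 4 * v ^ 4) =
      4 * ((logDTwo ψ - logD φ) * (logD φ - logD v)) := by
    rw [← h.logDTwo_sub_logD_phi, h.logD_phi_sub_logD_v]; ring
  have hw := mul_left_cancel₀ (by norm_num : (4 : K⟦X⟧) ≠ 0) hw
  have e1 : X * ψ ^ 4 * φ ^ 2 * v ^ 4 = φ⁻¹ ^ 6 * (16 * (logDTwo ψ - logD v) ^ 2 *
      ((logDTwo ψ - logD φ) * (logD φ - logD v))) := by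
    rw [hφ2, ← hw]
    linear_combination -(X * ψ ^ 4 * v ^ 4 * φ⁻¹ ^ 6 * (φ ^ 4 + 4 * (logDTwo ψ - logD v))) *
      h.logDTwo_sub_logD_v
  have e2 : X ^ 2 * ψ ^ 8 * v ^ 8 * φ⁻¹ ^ 6 =
      φ⁻¹ ^ 6 * ((logDTwo ψ - logD φ) * (logD φ - logD v)) ^ 2 := by
    rw [← hw]; ring
  rw [e1, e2]
  generalize φ⁻¹ ^ 6 = u at *
  have h6 : eulerD (6 : K⟦X⟧) = 0 := by simpa using (eulerD (K := K)).map_natCast (n := 6)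
  have h2 : eulerD (2 : K⟦X⟧) = 0 := by simpa using (eulerD (K := K)).map_natCast (n := 2)
  rw [hu]
  simp only [Derivation.leibniz, smul_eq_mul, map_add, map_sub, map_neg, h2, h6, hu,
    h.eulerD_logD_phi, h.eulerD_logDTwo, h.eulerD_logD_v, map_zero]
  ring

end IsLandenTriple

end Formal

/-! ### Expansions in powers of the nome -/

section QExpansions

open PowerSeries Filter Topology

theorem nome_eq_qParam (τ : ℍ) : nome τ = Function.Periodic.qParam 2 τ := by
  rw [nome, Function.Periodic.qParam]
  congr 1
  push_cast
  ring

theorem nome_ne_zero (τ : ℍ) : nome τ ≠ 0 := Complex.exp_ne_zero _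

theorem norm_nome (τ : ℍ) : ‖nome τ‖ = Real.exp (-Real.pi * τ.im) := by
  rw [nome, Complex.norm_exp]
  congr 1
  simp

theorem tendsto_nome_atImInfty : Tendsto nome atImInfty (𝓝 0) := by
  have := qParam_tendsto_atImInfty (h := 2) two_pos
  exact this.congr fun τ => (nome_eq_qParam τ).symm

/-- `F(τ) = A(q)` on the upper half plane, where `q = exp (π i τ)` and `A` is a formal power series
with complex coefficients. -/
def HasQExp (F : ℍ → ℂ) (A : ℂ⟦X⟧) : Prop :=
  ∀ τ : ℍ, HasSum (fun n : ℕ => coeff n A * nome τ ^ n) (F τ)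

namespace HasQExp

variable {F G : ℍ → ℂ} {A B : ℂ⟦X⟧}

theorem add (hF : HasQExp F A) (hG : HasQExp G B) : HasQExp (F + G) (A + B) := fun τ => by
  simpa [add_mul] using (hF τ).add (hG τ)

theorem sub (hF : HasQExp F A) (hG : HasQExp G B) : HasQExp (F - G) (A - B) := fun τ => by
  simpa [sub_mul] using (hF τ).sub (hG τ)

theorem mul (hF : HasQExp F A) (hG : HasQExp G B) : HasQExp (F * G) (A * B) := fun τ => by
  have h1 := (hF τ).summable.norm
  have h2 := (hG τ).summable.norm
  have h3 := (summable_norm_sum_mul_antidiagonal_of_summable_norm h1 h2).of_norm.hasSum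
  rw [← tsum_mul_tsum_eq_tsum_sum_antidiagonal_of_summable_norm h1 h2, (hF τ).tsum_eq,
    (hG τ).tsum_eq] at h3
  have h4 : (fun n => coeff n (A * B) * nome τ ^ n) = fun n =>
      ∑ p ∈ Finset.HasAntidiagonal.antidiagonal n,
        coeff p.1 A * nome τ ^ p.1 * (coeff p.2 B * nome τ ^ p.2) := by
    ext n
    rw [coeff_mul, Finset.sum_mul]
    refine Finset.sum_congr rfl fun p hp => ?_
    rw [← Finset.HasAntidiagonal.mem_antidiagonal.mp hp, pow_add]
    ring
  rw [h4]
  exact h3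

theorem C (c : ℂ) : HasQExp (fun _ => c) (PowerSeries.C c) := fun τ => by
  convert hasSum_single (f := fun n => coeff n (PowerSeries.C c) * nome τ ^ n) 0 ?_ using 1
  · simp
  · intro n hn
    simp [coeff_C, hn]

theorem X : HasQExp nome PowerSeries.X := fun τ => by
  convert hasSum_single (f := fun n => coeff n (PowerSeries.X : ℂ⟦X⟧) * nome τ ^ n) 1 ?_ using 1
  · simp
  · intro n hn
    simp [coeff_X, hn]

theorem one : HasQExp 1 1 := by
  simpa using! HasQExp.C 1

theorem pow (hF : HasQExp F A) (n : ℕ) : HasQExp (F ^ n) (A ^ n) := by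
  induction n with
  | zero => simpa using one
  | succ n ih => simpa [pow_succ] using ih.mul hF

theorem isBoundedAtImInfty (hF : HasQExp F A) : IsBoundedAtImInfty F :=
  isBoundedAtImInfty_of_hasSum_qExpansion (h := 2) two_pos (c := fun n => coeff n A)
    fun τ => by simpa [nome_eq_qParam] using hF τ

theorem shift (hF : HasQExp F A) :
    HasQExp (fun τ => (F τ - constantCoeff A) / nome τ) (mk fun n => coeff (n + 1) A) := fun τ => by
  have h1 := ((hasSum_nat_add_iff' 1).mpr (hF τ)).div_const (nome τ)
  simp only [Finset.sum_range_one, pow_zero, mul_one, coeff_zero_eq_constantCoeff] at h1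
  have h2 : (fun n => coeff n (mk fun n => coeff (n + 1) A) * nome τ ^ n) =
      fun n => coeff (n + 1) A * nome τ ^ (n + 1) / nome τ := by
    ext n
    rw [coeff_mk, pow_succ, ← mul_assoc, mul_div_cancel_right₀ _ (nome_ne_zero τ)]
  rw [h2]
  exact h1

/-- A function with a `q`-expansion tends to the constant term at `i∞`: off the constant term it is
`q` times a bounded function. -/
theorem tendsto (hF : HasQExp F A) : Tendsto F atImInfty (𝓝 (constantCoeff A)) := by
  have h0 : Tendsto (fun τ => nome τ * ((F τ - constantCoeff A) / nome τ)) atImInfty (𝓝 0) := by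
    have hb : (fun τ => (F τ - constantCoeff A) / nome τ) =O[atImInfty] (1 : ℍ → ℝ) :=
      hF.shift.isBoundedAtImInfty
    have hn : nome =o[atImInfty] (1 : ℍ → ℝ) :=
      (Asymptotics.isLittleO_one_iff ℝ).mpr tendsto_nome_atImInfty
    have := hn.mul_isBigO hb
    simp only [Pi.one_apply, mul_one] at this
    exact (Asymptotics.isLittleO_one_iff ℝ).mp this
  have := h0.add_const (constantCoeff A)
  rw [zero_add] at this
  refine this.congr fun τ => ?_
  rw [mul_div_cancel₀ _ (nome_ne_zero τ), sub_add_cancel]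

/-- The coefficients are determined one after the other as limits at `i∞`. -/
theorem unique (hA : HasQExp F A) (hB : HasQExp F B) : A = B := by
  have key : ∀ (n : ℕ) (D : ℂ⟦X⟧), HasQExp 0 D → coeff n D = 0 := by
    intro n
    induction n with
    | zero =>
      intro D hD
      rw [coeff_zero_eq_constantCoeff]
      exact tendsto_nhds_unique hD.tendsto tendsto_const_nhds
    | succ n ih =>
      intro D hD
      have h0 : constantCoeff D = 0 := tendsto_nhds_unique hD.tendsto tendsto_const_nhds
      have h1 := hD.shift
      simp only [h0, Pi.zero_apply, sub_zero, zero_div] at h1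
      simpa using ih _ h1
  have h := hA.sub hB
  rw [sub_self] at h
  ext n
  simpa [sub_eq_zero] using key n _ h

theorem periodic (hF : HasQExp F A) : Function.Periodic (F ∘ ofComplex) 2 := by
  intro w
  by_cases! hw : 0 < im w
  · have h2 : 0 < im (w + 2) := by simpa using hw
    simp only [Function.comp_apply, ofComplex_apply_of_im_pos h2, ofComplex_apply_of_im_pos hw]
    have : nome ⟨w + 2, h2⟩ = nome ⟨w, hw⟩ := by
      rw [nome, nome, Complex.exp_eq_exp_iff_exists_int]
      exact ⟨1, by simp; ring⟩
    have h3 := hF ⟨w + 2, h2⟩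
    rw [this] at h3
    exact h3.unique (hF ⟨w, hw⟩)
  · have h2 : im (w + 2) ≤ 0 := by simpa using hw
    simp [ofComplex_apply_of_im_nonpos h2, ofComplex_apply_of_im_nonpos hw]

/-- The inverse is holomorphic, periodic and bounded at `i∞`, so it has some expansion, which can
only be the inverse power series. -/
theorem inv (hF : HasQExp F A) (hd : MDiff F) (h0 : ∀ τ, F τ ≠ 0) (hA : constantCoeff A ≠ 0) :
    HasQExp F⁻¹ A⁻¹ := by
  have hper : Function.Periodic (F⁻¹ ∘ ofComplex) 2 := fun w => by
    simpa using congrArg (·⁻¹) (hF.periodic w)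
  have hd' : MDiff F⁻¹ := by
    rw [mdifferentiable_iff] at hd ⊢
    exact hd.inv fun z _ => h0 _
  have hbdd : IsBoundedAtImInfty F⁻¹ := (hF.tendsto.inv₀ hA).isBigO_one ℝ
  have hexp : HasQExp F⁻¹ (qExpansion 2 F⁻¹) := fun τ => by
    simpa [nome_eq_qParam] using
      hasSum_qExpansion (h := 2) two_pos (by exact_mod_cast hper) hd' hbdd τ
  have h1 : A * qExpansion 2 F⁻¹ = 1 := by
    refine (hF.mul hexp).unique ?_
    have : F * F⁻¹ = 1 := by ext τ; simp [h0 τ]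
    rw [this]
    exact one
  have h2 : qExpansion 2 F⁻¹ = A⁻¹ :=
    (PowerSeries.eq_inv_iff_mul_eq_one hA).mpr (by rw [mul_comm]; exact h1)
  rwa [h2] at hexp

end HasQExp

/-- The power series `∑ i, c i * X ^ (e i)`. -/
noncomputable def genSeries {ι : Type*} (c : ι → ℂ) (e : ι → ℕ) : ℂ⟦X⟧ :=
  mk fun n => ∑' i : {i // e i = n}, c i

theorem eulerD_genSeries {ι : Type*} (c : ι → ℂ) (e : ι → ℕ) :
    eulerD (genSeries c e) = genSeries (fun i => e i * c i) e := by
  ext n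
  rw [coeff_eulerD, genSeries, genSeries, coeff_mk, coeff_mk, ← tsum_mul_left]
  exact tsum_congr fun i => by rw [i.2]

theorem hasQExp_genSeries {ι : Type*} {c : ι → ℂ} {e : ι → ℕ} {F : ℍ → ℂ}
    (h : ∀ τ, HasSum (fun i => c i * nome τ ^ e i) (F τ)) : HasQExp F (genSeries c e) := by
  intro τ
  have h1 := (Equiv.sigmaFiberEquiv e).hasSum_iff.mpr (h τ)
  refine h1.sigma fun n => ?_
  have hs : Summable fun i : {i // e i = n} => c i * nome τ ^ e i :=
    (h τ).summable.comp_injective Subtype.val_injective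
  have := hs.hasSum
  rw [genSeries, coeff_mk, ← tsum_mul_right]
  have h2 : ∑' i : {i // e i = n}, c i * nome τ ^ n = ∑' i : {i // e i = n}, c i * nome τ ^ e i :=
    tsum_congr fun i => by rw [i.2]
  rw [h2]
  exact this

end QExpansions

/-! ### Theta constants -/

section ThetaConstants

open PowerSeries Filter Topology

/-- The Jacobi theta constant `θ₄(τ) = ∑_{n ∈ ℤ} (-1)ⁿ q^{n²}`. -/
noncomputable def thetaFour (τ : ℍ) : ℂ := ∑' n : ℤ, (-1) ^ n * nome τ ^ (n ^ 2)

/-- `∑_{n ∈ ℤ} q^{n² + n} = θ₂ / q^{1/4}`. -/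
noncomputable def thetaTwoAux (τ : ℍ) : ℂ := ∑' n : ℤ, nome τ ^ (n ^ 2 + n)

theorem nome_zpow (τ : ℍ) (k : ℤ) : nome τ ^ k = cexp (Real.pi * I * τ * k) := by
  rw [nome, ← Complex.exp_int_mul]
  ring_nf

theorem jacobiTheta₂_term_zero (n : ℤ) (τ : ℍ) : jacobiTheta₂_term n 0 τ = nome τ ^ (n ^ 2) := by
  rw [jacobiTheta₂_term, nome_zpow]
  push_cast
  ring_nf

theorem neg_one_zpow_eq_exp (n : ℤ) : (-1 : ℂ) ^ n = cexp (Real.pi * I * n) := by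
  rw [← Complex.exp_pi_mul_I, ← Complex.exp_int_mul]
  ring_nf

theorem jacobiTheta₂_term_half (n : ℤ) (τ : ℍ) :
    jacobiTheta₂_term n (1 / 2) τ = (-1) ^ n * nome τ ^ (n ^ 2) := by
  rw [jacobiTheta₂_term, nome_zpow, neg_one_zpow_eq_exp, ← Complex.exp_add]
  push_cast
  ring_nf

theorem jacobiTheta₂_term_half_period (n : ℤ) (τ : ℍ) :
    jacobiTheta₂_term n (τ / 2) τ = nome τ ^ (n ^ 2 + n) := by
  rw [jacobiTheta₂_term, nome_zpow]
  push_cast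
  ring_nf

theorem thetaThree_eq_jacobiTheta₂ (τ : ℍ) : thetaThree τ = jacobiTheta₂ 0 τ :=
  tsum_congr fun n => by simp [jacobiTheta₂_term]

theorem thetaFour_eq_jacobiTheta₂ (τ : ℍ) : thetaFour τ = jacobiTheta₂ (1 / 2) τ :=
  tsum_congr fun n => (jacobiTheta₂_term_half n τ).symm

theorem thetaTwoAux_eq_jacobiTheta₂ (τ : ℍ) : thetaTwoAux τ = jacobiTheta₂ (τ / 2) τ :=
  tsum_congr fun n => (jacobiTheta₂_term_half_period n τ).symm

theorem thetaTwo_eq (τ : ℍ) : thetaTwo τ = cexp (Real.pi * I * τ / 4) * thetaTwoAux τ := by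
  rw [thetaTwo, thetaTwoAux, ← tsum_mul_left]
  refine tsum_congr fun n => ?_
  rw [nome_zpow, ← Complex.exp_add]
  push_cast
  ring_nf

theorem hasSum_thetaThree (τ : ℍ) : HasSum (fun n : ℤ => nome τ ^ (n ^ 2)) (thetaThree τ) := by
  rw [thetaThree_eq_jacobiTheta₂]
  exact (hasSum_jacobiTheta₂_term 0 τ.im_pos).congr_fun fun n => (jacobiTheta₂_term_zero n τ).symm

theorem hasSum_thetaFour (τ : ℍ) :
    HasSum (fun n : ℤ => (-1) ^ n * nome τ ^ (n ^ 2)) (thetaFour τ) := by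
  rw [thetaFour_eq_jacobiTheta₂]
  simpa only [jacobiTheta₂_term_half] using hasSum_jacobiTheta₂_term (1 / 2) τ.im_pos

theorem hasSum_thetaTwoAux (τ : ℍ) :
    HasSum (fun n : ℤ => nome τ ^ (n ^ 2 + n)) (thetaTwoAux τ) := by
  rw [thetaTwoAux_eq_jacobiTheta₂]
  simpa only [jacobiTheta₂_term_half_period] using hasSum_jacobiTheta₂_term (τ / 2) τ.im_pos

/-! ### Landen's transformation -/

/-- The sum over `ℤ²` split according to the parity of `m + n`. -/
theorem HasSum.int_prod_parity {f : ℤ × ℤ → ℂ} {s t : ℂ}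
    (h0 : HasSum (fun p : ℤ × ℤ => f (p.1 + p.2, p.1 - p.2)) s)
    (h1 : HasSum (fun p : ℤ × ℤ => f (p.1 + p.2 + 1, p.1 - p.2)) t) : HasSum f (s + t) := by
  let e0 : ℤ × ℤ → ℤ × ℤ := fun p => (p.1 + p.2, p.1 - p.2)
  let e1 : ℤ × ℤ → ℤ × ℤ := fun p => (p.1 + p.2 + 1, p.1 - p.2)
  have i0 : Function.Injective e0 := by
    rintro ⟨a, b⟩ ⟨c, d⟩ h
    simp only [e0, Prod.mk.injEq] at h ⊢
    omega
  have i1 : Function.Injective e1 := by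
    rintro ⟨a, b⟩ ⟨c, d⟩ h
    simp only [e1, Prod.mk.injEq] at h ⊢
    omega
  have hc : IsCompl (Set.range e0) (Set.range e1) := by
    constructor
    · rw [Set.disjoint_left]
      rintro _ ⟨⟨a, b⟩, rfl⟩ ⟨⟨c, d⟩, h⟩
      simp only [e0, e1, Prod.mk.injEq] at h
      omega
    · rw [codisjoint_iff_le_sup]
      rintro ⟨m, n⟩ -
      rcases Int.emod_two_eq_zero_or_one (m + n) with h | h
      · exact Or.inl ⟨((m + n) / 2, (m - n) / 2), by simp only [e0, Prod.mk.injEq]; omega⟩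
      · exact Or.inr ⟨((m + n - 1) / 2, (m - n - 1) / 2), by
          simp only [e1, Prod.mk.injEq]; omega⟩
  exact HasSum.add_isCompl hc (i0.hasSum_range_iff.mpr h0) (i1.hasSum_range_iff.mpr h1)

theorem HasSum.prod_mul {ι κ : Type*} {f : ι → ℂ} {g : κ → ℂ} {s t : ℂ} (hf : HasSum f s)
    (hg : HasSum g t) : HasSum (fun p : ι × κ => f p.1 * g p.2) (s * t) :=
  hf.mul hg (summable_mul_of_summable_norm hf.summable.norm hg.summable.norm)

/-- The point `2 τ` of the upper half plane. -/
noncomputable def twice (τ : ℍ) : ℍ := ⟨2 * τ, by simpa using τ.im_pos⟩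

theorem nome_twice (τ : ℍ) : nome (twice τ) = nome τ ^ 2 := by
  rw [nome, nome, ← Complex.exp_nat_mul]
  simp only [twice]
  push_cast
  ring_nf

theorem nome_twice_zpow (τ : ℍ) (k : ℤ) : nome (twice τ) ^ k = nome τ ^ (2 * k) := by
  rw [nome_twice, zpow_mul]
  norm_cast

theorem thetaThree_sq (τ : ℍ) : thetaThree τ ^ 2 =
    thetaThree (twice τ) ^ 2 + nome τ * thetaTwoAux (twice τ) ^ 2 := by
  have hq := nome_ne_zero τ
  have h := (hasSum_thetaThree τ).prod_mul (hasSum_thetaThree τ)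
  rw [pow_two, pow_two, pow_two]
  refine h.unique (HasSum.int_prod_parity ?_ ?_)
  · refine ((hasSum_thetaThree (twice τ)).prod_mul
      (hasSum_thetaThree (twice τ))).congr_fun fun p => ?_
    dsimp only
    simp only [nome_twice_zpow, ← zpow_add₀ hq]
    ring_nf
  · refine (((hasSum_thetaTwoAux (twice τ)).prod_mul (hasSum_thetaTwoAux (twice τ))).mul_left
      (nome τ)).congr_fun fun p => ?_
    dsimp only
    simp only [nome_twice_zpow, ← zpow_add₀ hq, ← zpow_one_add₀ hq]
    ring_nf

theorem thetaFour_sq (τ : ℍ) : thetaFour τ ^ 2 =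
    thetaThree (twice τ) ^ 2 - nome τ * thetaTwoAux (twice τ) ^ 2 := by
  have hq := nome_ne_zero τ
  have h := (hasSum_thetaFour τ).prod_mul (hasSum_thetaFour τ)
  rw [pow_two, pow_two, pow_two, sub_eq_add_neg]
  refine h.unique (HasSum.int_prod_parity ?_ ?_)
  · refine ((hasSum_thetaThree (twice τ)).prod_mul
      (hasSum_thetaThree (twice τ))).congr_fun fun p => ?_
    dsimp only
    have h1 : (-1 : ℂ) ^ (p.1 + p.2) * (-1) ^ (p.1 - p.2) = 1 := by
      rw [← zpow_add₀ (by norm_num)]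
      exact Even.neg_one_zpow ⟨p.1, by ring⟩
    rw [mul_mul_mul_comm, h1, one_mul]
    simp only [nome_twice_zpow, ← zpow_add₀ hq]
    ring_nf
  · refine ((((hasSum_thetaTwoAux (twice τ)).prod_mul (hasSum_thetaTwoAux (twice τ))).mul_left
      (nome τ)).neg).congr_fun fun p => ?_
    dsimp only
    have h1 : (-1 : ℂ) ^ (p.1 + p.2 + 1) * (-1) ^ (p.1 - p.2) = -1 := by
      rw [← zpow_add₀ (by norm_num)]
      exact Odd.neg_one_zpow ⟨p.1, by ring⟩
    rw [mul_mul_mul_comm, h1, neg_one_mul]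
    simp only [nome_twice_zpow, ← zpow_add₀ hq, ← zpow_one_add₀ hq]
    ring_nf

theorem thetaTwoAux_sq (τ : ℍ) : thetaTwoAux τ ^ 2 =
    2 * (thetaThree (twice τ) * thetaTwoAux (twice τ)) := by
  have hq := nome_ne_zero τ
  have h := (hasSum_thetaTwoAux τ).prod_mul (hasSum_thetaTwoAux τ)
  rw [pow_two, two_mul]
  refine h.unique (HasSum.int_prod_parity ?_ ?_)
  · have h2 := (hasSum_thetaTwoAux (twice τ)).prod_mul (hasSum_thetaThree (twice τ))
    rw [mul_comm (thetaThree _)]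
    refine (h2).congr_fun fun p => ?_
    dsimp only
    simp only [nome_twice_zpow, ← zpow_add₀ hq]
    ring_nf
  · have h2 : HasSum (fun n : ℤ => nome (twice τ) ^ ((n + 1) ^ 2)) (thetaThree (twice τ)) := by
      have := (Equiv.addRight (1 : ℤ)).hasSum_iff.mpr (hasSum_thetaThree (twice τ))
      exact this.congr_fun fun n => by rw [Function.comp_apply, Equiv.coe_addRight]
    refine (h2.prod_mul (hasSum_thetaTwoAux (twice τ))).congr_fun fun p => ?_
    dsimp only
    simp only [nome_twice_zpow, ← zpow_add₀ hq]
    ring_nf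

theorem thetaThree_mul_thetaFour (τ : ℍ) :
    thetaThree τ * thetaFour τ = thetaFour (twice τ) ^ 2 := by
  have hq := nome_ne_zero τ
  have h := (hasSum_thetaThree τ).prod_mul (hasSum_thetaFour τ)
  have hs : Summable fun n : ℤ => (-1 : ℂ) ^ n * nome (twice τ) ^ (n ^ 2 + n) := by
    refine Summable.of_norm ?_
    simpa using (hasSum_thetaTwoAux (twice τ)).summable.norm
  -- the involution `n ↦ -1 - n` shows that `∑ (-1)ⁿ q^(n² + n)` vanishes
  have h0 : HasSum (fun n : ℤ => (-1 : ℂ) ^ n * nome (twice τ) ^ (n ^ 2 + n)) 0 := by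
    have h1 := (Equiv.subLeft (-1 : ℤ)).hasSum_iff.mpr hs.hasSum
    have h2 : ((fun n : ℤ => (-1 : ℂ) ^ n * nome (twice τ) ^ (n ^ 2 + n)) ∘
        Equiv.subLeft (-1 : ℤ)) = fun n : ℤ => -((-1 : ℂ) ^ n * nome (twice τ) ^ (n ^ 2 + n)) := by
      ext n
      have : (-1 : ℂ) ^ (-1 - n) = -(-1) ^ n := by
        rw [zpow_sub₀ (by norm_num), zpow_neg_one]
        rcases Int.even_or_odd n with hn | hn
        · simp [hn.neg_one_zpow]
        · simp [hn.neg_one_zpow]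
      simp only [Function.comp_apply, Equiv.subLeft_apply, this]
      ring_nf
    rw [h2] at h1
    have h3 := h1.unique hs.hasSum.neg
    have h4 := hs.hasSum
    rwa [self_eq_neg.mp h3] at h4
  rw [pow_two, ← add_zero (thetaFour (twice τ) * _)]
  refine h.unique (HasSum.int_prod_parity ?_ ?_)
  · refine ((hasSum_thetaFour (twice τ)).prod_mul
      (hasSum_thetaFour (twice τ))).congr_fun fun p => ?_
    dsimp only
    have h1 : (-1 : ℂ) ^ (p.1 - p.2) = (-1) ^ p.1 * (-1) ^ p.2 := by
      rw [zpow_sub₀ (by norm_num), div_eq_mul_inv, ← inv_zpow]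
      norm_num
    rw [h1, mul_mul_mul_comm, mul_left_comm]
    simp only [nome_twice_zpow, ← zpow_add₀ hq]
    ring_nf
  · have h2 := (h0.prod_mul h0).mul_left (nome τ)
    rw [mul_zero, mul_zero] at h2
    refine (h2).congr_fun fun p => ?_
    dsimp only
    have h1 : (-1 : ℂ) ^ (p.1 - p.2) = (-1) ^ p.1 * (-1) ^ p.2 := by
      rw [zpow_sub₀ (by norm_num), div_eq_mul_inv, ← inv_zpow]
      norm_num
    rw [h1, mul_mul_mul_comm, mul_left_comm, mul_left_comm (nome τ)]
    simp only [nome_twice_zpow, ← zpow_add₀ hq, ← zpow_one_add₀ hq]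
    ring_nf

/-! ### Limits, nonvanishing and holomorphy -/

/-- The power series of `θ₃` in `q`. -/
noncomputable def phiSeries : ℂ⟦X⟧ := genSeries (fun _ : ℤ => 1) fun n => n.natAbs ^ 2

/-- The power series of `θ₄` in `q`. -/
noncomputable def vSeries : ℂ⟦X⟧ := genSeries (fun n : ℤ => (-1) ^ n) fun n => n.natAbs ^ 2

/-- The power series of `θ₂ / (2 q^{1/4})` in `q`. -/
noncomputable def psiSeries : ℂ⟦X⟧ := genSeries (fun _ : ℕ => 1) fun n => n ^ 2 + n

theorem nome_zpow_sq (τ : ℍ) (n : ℤ) : nome τ ^ (n ^ 2) = nome τ ^ (n.natAbs ^ 2) := by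
  rw [← zpow_natCast]
  simp

theorem hasQExp_thetaThree : HasQExp thetaThree phiSeries :=
  hasQExp_genSeries fun τ => (hasSum_thetaThree τ).congr_fun fun n => by
    rw [nome_zpow_sq, one_mul]

theorem hasQExp_thetaFour : HasQExp thetaFour vSeries :=
  hasQExp_genSeries fun τ => (hasSum_thetaFour τ).congr_fun fun n => by
    rw [nome_zpow_sq]

theorem hasSum_thetaTwoAux_nat (τ : ℍ) :
    HasSum (fun n : ℕ => nome τ ^ (n ^ 2 + n)) (thetaTwoAux τ / 2) := by
  have hs : Summable fun n : ℕ => nome τ ^ (n ^ 2 + n) :=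
    ((hasSum_thetaTwoAux τ).summable.comp_injective Nat.cast_injective).congr fun n => by
      rw [Function.comp_apply, ← zpow_natCast]
      push_cast
      rfl
  have h1 : HasSum (fun n : ℤ => nome τ ^ (n ^ 2 + n))
      ((∑' n : ℕ, nome τ ^ (n ^ 2 + n)) + ∑' n : ℕ, nome τ ^ (n ^ 2 + n)) := by
    refine HasSum.of_nat_of_neg_add_one (hs.hasSum.congr_fun fun n => ?_)
      (hs.hasSum.congr_fun fun n => ?_)
    · rw [← zpow_natCast]
      push_cast
      rfl
    · rw [← zpow_natCast]
      push_cast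
      ring_nf
  rw [(hasSum_thetaTwoAux τ).unique h1, add_self_div_two]
  exact hs.hasSum

theorem hasQExp_thetaTwoAux : HasQExp (fun τ => thetaTwoAux τ / 2) psiSeries :=
  hasQExp_genSeries fun τ => (hasSum_thetaTwoAux_nat τ).congr_fun fun n => by rw [one_mul]

theorem HasQExp.twice {F : ℍ → ℂ} {A : ℂ⟦X⟧} (h : HasQExp F A) :
    HasQExp (fun τ => F (twice τ)) (dbl A) := fun τ => by
  have hi : Function.Injective fun n : ℕ => 2 * n := fun a b hab => by simpa using hab
  refine (hi.hasSum_iff fun n hn => ?_).mp ((h (_root_.twice τ)).congr_fun fun n => ?_)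
  · rw [coeff_expand_of_not_dvd, zero_mul]
    rintro ⟨m, rfl⟩
    exact hn ⟨m, rfl⟩
  · rw [Function.comp_apply, coeff_expand_mul, nome_twice, pow_mul]

theorem isLandenTriple_theta : IsLandenTriple phiSeries vSeries psiSeries := by
  have hX (F : ℍ → ℂ) (A : ℂ⟦X⟧) (hF : HasQExp F A) :
      HasQExp (fun τ => 4 * (nome τ * F τ)) (4 * X * A) := by
    have := (HasQExp.C 4).mul (HasQExp.X.mul hF)
    rw [map_ofNat, ← mul_assoc 4 PowerSeries.X A] at this
    exact this
  refine ⟨?_, ?_, ?_, ?_, ?_, ?_, ?_⟩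
  · have : Unique {n : ℤ // n.natAbs ^ 2 = 0} := ⟨⟨⟨0, rfl⟩⟩, fun ⟨n, hn⟩ => by simpa using hn⟩
    rw [phiSeries, genSeries, ← coeff_zero_eq_constantCoeff_apply, coeff_mk]
    simp
  · have : Unique {n : ℤ // n.natAbs ^ 2 = 0} := ⟨⟨⟨0, rfl⟩⟩, fun ⟨n, hn⟩ => by simpa using hn⟩
    rw [vSeries, genSeries, ← coeff_zero_eq_constantCoeff_apply, coeff_mk, tsum_fintype,
      Fintype.sum_unique]
    have hd : ((default : {n : ℤ // n.natAbs ^ 2 = 0}) : ℤ) = 0 := by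
      simpa using (default : {n : ℤ // n.natAbs ^ 2 = 0}).2
    rw [hd, zpow_zero]
  · have : Unique {n : ℕ // n ^ 2 + n = 0} := ⟨⟨⟨0, rfl⟩⟩, fun ⟨n, hn⟩ => by simpa using hn⟩
    rw [psiSeries, genSeries, ← coeff_zero_eq_constantCoeff_apply, coeff_mk]
    simp
  · refine (hasQExp_thetaThree.pow 2).unique ?_
    convert (hasQExp_thetaThree.twice.pow 2).add (hX _ _ (hasQExp_thetaTwoAux.twice.pow 2)) using 1
    ext τ
    simp only [Pi.pow_apply, Pi.add_apply]
    rw [thetaThree_sq]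
    ring
  · refine (hasQExp_thetaFour.pow 2).unique ?_
    convert (hasQExp_thetaThree.twice.pow 2).sub (hX _ _ (hasQExp_thetaTwoAux.twice.pow 2)) using 1
    ext τ
    simp only [Pi.pow_apply, Pi.sub_apply]
    rw [thetaFour_sq]
    ring
  · refine (hasQExp_thetaTwoAux.pow 2).unique ?_
    convert hasQExp_thetaThree.twice.mul hasQExp_thetaTwoAux.twice using 1
    ext τ
    simp only [Pi.pow_apply, Pi.mul_apply]
    rw [div_pow, thetaTwoAux_sq]
    ring
  · refine (hasQExp_thetaThree.mul hasQExp_thetaFour).unique ?_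
    convert hasQExp_thetaFour.twice.pow 2 using 1
    ext τ
    simp only [Pi.pow_apply, Pi.mul_apply]
    rw [thetaThree_mul_thetaFour]

/-- A zero of `θ₄` at `τ` propagates to the points `2 ^ k τ`, which tend to `i∞`, where `θ₄` tends
to `1`. -/
theorem thetaFour_ne_zero (τ : ℍ) : thetaFour τ ≠ 0 := by
  intro h0
  have hk : ∀ k : ℕ, thetaFour (_root_.twice^[k] τ) = 0 := by
    intro k
    induction k with
    | zero => exact h0
    | succ k ih =>
      have := thetaThree_mul_thetaFour (_root_.twice^[k] τ)
      rw [ih, mul_zero] at this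
      rw [Function.iterate_succ_apply']
      exact pow_eq_zero_iff two_ne_zero |>.mp this.symm
  have him : ∀ k : ℕ, (_root_.twice^[k] τ).im = 2 ^ k * τ.im := by
    intro k
    induction k with
    | zero => simp
    | succ k ih =>
      rw [Function.iterate_succ_apply', pow_succ']
      have : (_root_.twice (_root_.twice^[k] τ)).im = 2 * (_root_.twice^[k] τ).im := by
        rw [← coe_im, ← coe_im, _root_.twice]
        simp
      rw [this, ih]
      ring
  have hlim : Tendsto (fun k : ℕ => _root_.twice^[k] τ) atTop atImInfty := by
    rw [atImInfty, tendsto_comap_iff]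
    simp only [Function.comp_def, him]
    exact (tendsto_pow_atTop_atTop_of_one_lt one_lt_two).atTop_mul_const τ.im_pos
  have h1 := hasQExp_thetaFour.tendsto.comp hlim
  rw [isLandenTriple_theta.const_v] at h1
  refine zero_ne_one (α := ℂ) (tendsto_nhds_unique (tendsto_const_nhds.congr fun k => ?_) h1)
  exact (hk k).symm

/-! ### Transformation laws -/

theorem coe_T_smul (τ : ℍ) : ((ModularGroup.T • τ : ℍ) : ℂ) = τ + 1 := by
  rw [modular_T_smul, coe_vadd]
  push_cast
  ring

theorem coe_S_smul (τ : ℍ) : ((ModularGroup.S • τ : ℍ) : ℂ) = -1 / τ := by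
  rw [modular_S_smul]
  change (-(τ : ℂ))⁻¹ = -1 / τ
  rw [inv_neg, neg_div, one_div]

theorem nome_T_smul (τ : ℍ) : nome (ModularGroup.T • τ) = -nome τ := by
  rw [nome, nome, coe_T_smul, mul_add, mul_one, Complex.exp_add, Complex.exp_pi_mul_I]
  ring

theorem neg_one_zpow_sq (n : ℤ) : (-1 : ℂ) ^ (n ^ 2) = (-1) ^ n := by
  rcases Int.even_or_odd n with hn | hn
  · rw [hn.neg_one_zpow, (hn.pow_of_ne_zero two_ne_zero).neg_one_zpow]
  · rw [hn.neg_one_zpow, hn.pow.neg_one_zpow]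

theorem nome_T_smul_zpow_sq (τ : ℍ) (n : ℤ) :
    nome (ModularGroup.T • τ) ^ (n ^ 2) = (-1) ^ n * nome τ ^ (n ^ 2) := by
  rw [nome_T_smul, ← neg_one_mul, mul_zpow, neg_one_zpow_sq]

theorem thetaThree_T_smul (τ : ℍ) : thetaThree (ModularGroup.T • τ) = thetaFour τ :=
  (hasSum_thetaThree _).unique ((hasSum_thetaFour τ).congr_fun fun n => nome_T_smul_zpow_sq τ n)

theorem thetaFour_T_smul (τ : ℍ) : thetaFour (ModularGroup.T • τ) = thetaThree τ := by
  refine (hasSum_thetaFour _).unique ((hasSum_thetaThree τ).congr_fun fun n => ?_)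
  rw [nome_T_smul_zpow_sq, ← mul_assoc, ← mul_zpow]
  simp

theorem thetaTwoAux_T_smul (τ : ℍ) : thetaTwoAux (ModularGroup.T • τ) = thetaTwoAux τ := by
  refine tsum_congr fun n => ?_
  rw [nome_T_smul, ← neg_one_mul, mul_zpow, Even.neg_one_zpow, one_mul]
  rw [pow_two, ← mul_add_one]
  exact Int.even_mul_succ_self n

theorem thetaTwo_T_smul_sq (τ : ℍ) :
    thetaTwo (ModularGroup.T • τ) ^ 2 = I * thetaTwo τ ^ 2 := by
  have h : cexp (Real.pi * I * (τ + 1) / 4) ^ 2 = I * cexp (Real.pi * I * τ / 4) ^ 2 := by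
    have hI : I = cexp (Real.pi / 2 * I) := Complex.exp_pi_div_two_mul_I.symm
    calc cexp (Real.pi * I * (τ + 1) / 4) ^ 2
        = cexp (Real.pi / 2 * I) * cexp (Real.pi * I * τ / 4) ^ 2 := by
          rw [← Complex.exp_nat_mul, ← Complex.exp_nat_mul, ← Complex.exp_add]
          push_cast
          ring_nf
      _ = _ := by rw [← hI]
  rw [thetaTwo_eq, thetaTwo_eq, thetaTwoAux_T_smul, coe_T_smul, mul_pow, h]
  ring

theorem sqrt_factor_sq (τ : ℍ) : ((-I * τ : ℂ) ^ (1 / 2 : ℂ)) ^ 2 = -I * τ := by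
  rw [← Complex.cpow_nat_mul]
  simp

theorem sqrt_factor_ne_zero (τ : ℍ) : (-I * τ : ℂ) ^ (1 / 2 : ℂ) ≠ 0 := by
  intro h
  have := sqrt_factor_sq τ
  rw [h] at this
  simp [τ.ne_zero] at this

theorem thetaThree_S_smul_sq (τ : ℍ) :
    thetaThree (ModularGroup.S • τ) ^ 2 = -I * τ * thetaThree τ ^ 2 := by
  have h := jacobiTheta₂_functional_equation 0 τ
  have h0 := sqrt_factor_ne_zero τ
  have h2 := sqrt_factor_sq τ
  rw [← coe_S_smul, zero_div, ← thetaThree_eq_jacobiTheta₂, ← thetaThree_eq_jacobiTheta₂] at h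
  generalize (-I * τ : ℂ) ^ (1 / 2 : ℂ) = s at h h0 h2
  rw [h, ← h2]
  simp only [ne_eq, OfNat.ofNat_ne_zero, not_false_eq_true, zero_pow, mul_zero, zero_div,
    Complex.exp_zero]
  field_simp

theorem thetaTwo_S_smul_sq (τ : ℍ) :
    thetaTwo (ModularGroup.S • τ) ^ 2 = -I * τ * thetaFour τ ^ 2 := by
  have h := jacobiTheta₂_functional_equation (1 / 2) τ
  have h0 := sqrt_factor_ne_zero τ
  have h2 := sqrt_factor_sq τ
  have hτ := τ.ne_zero
  have h3 : jacobiTheta₂ (1 / 2 / τ) (-1 / τ) = thetaTwoAux (ModularGroup.S • τ) := by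
    rw [thetaTwoAux_eq_jacobiTheta₂, coe_S_smul, ← jacobiTheta₂_neg_left]
    congr 1
    field_simp
  have h4 : cexp (-Real.pi * I * (1 / 2) ^ 2 / τ) =
      cexp (Real.pi * I * (ModularGroup.S • τ : ℍ) / 4) := by
    rw [coe_S_smul]
    congr 1
    field_simp
    norm_num
  rw [← thetaFour_eq_jacobiTheta₂, h3, mul_assoc, h4, ← thetaTwo_eq] at h
  generalize (-I * τ : ℂ) ^ (1 / 2 : ℂ) = s at h h0 h2
  rw [h, ← h2]
  field_simp

theorem thetaFour_S_smul_sq (τ : ℍ) :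
    thetaFour (ModularGroup.S • τ) ^ 2 = -I * τ * thetaTwo τ ^ 2 := by
  have h := thetaTwo_S_smul_sq (ModularGroup.S • τ)
  have h2 : ModularGroup.S • ModularGroup.S • τ = τ := by
    ext
    rw [coe_S_smul, coe_S_smul]
    have := τ.ne_zero
    field_simp
  rw [h2, coe_S_smul] at h
  have := τ.ne_zero
  rw [h]
  field_simp
  rw [I_sq]
  ring

theorem thetaThree_ne_zero (τ : ℍ) : thetaThree τ ≠ 0 := by
  have h : ModularGroup.T • (ModularGroup.T⁻¹ • τ) = τ := smul_inv_smul _ _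
  rw [← h, thetaThree_T_smul]
  exact thetaFour_ne_zero _

theorem thetaTwo_ne_zero (τ : ℍ) : thetaTwo τ ≠ 0 := by
  intro h0
  have h := thetaFour_S_smul_sq τ
  rw [h0] at h
  exact thetaFour_ne_zero _ (by simpa using h)

theorem mdifferentiable_thetaThree : MDiff thetaThree := by
  rw [mdifferentiable_iff]
  have h : DifferentiableOn ℂ (jacobiTheta₂ 0) {z | 0 < z.im} := fun z hz =>
    (differentiableAt_jacobiTheta₂_snd 0 hz).differentiableWithinAt
  refine h.congr fun z hz => ?_
  rw [Function.comp_apply, thetaThree_eq_jacobiTheta₂, ofComplex_apply_of_im_pos hz]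

theorem mdifferentiable_thetaFour : MDiff thetaFour := by
  rw [mdifferentiable_iff]
  have h : DifferentiableOn ℂ (jacobiTheta₂ (1 / 2)) {z | 0 < z.im} := fun z hz =>
    (differentiableAt_jacobiTheta₂_snd (1 / 2) hz).differentiableWithinAt
  refine h.congr fun z hz => ?_
  rw [Function.comp_apply, thetaFour_eq_jacobiTheta₂, ofComplex_apply_of_im_pos hz]

theorem mdifferentiable_thetaTwo : MDiff thetaTwo := by
  rw [mdifferentiable_iff]
  have h : DifferentiableOn ℂ (fun z => cexp (Real.pi * I * z / 4) * jacobiTheta₂ (z / 2) z)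
      {z | 0 < z.im} := fun z hz => by
    have h1 := hasFDerivAt_jacobiTheta₂ (z / 2) hz
    have h2 : DifferentiableAt ℂ (fun z : ℂ => (z / 2, z)) z := by fun_prop
    have h3 : DifferentiableAt ℂ (fun z => jacobiTheta₂ (z / 2) z) z :=
      DifferentiableAt.comp (f := fun z : ℂ => (z / 2, z))
        (g := fun p : ℂ × ℂ => jacobiTheta₂ p.1 p.2) z h1.differentiableAt h2
    exact ((by fun_prop : DifferentiableAt ℂ (fun z => cexp (Real.pi * I * z / 4)) z).mul
      h3).differentiableWithinAt
  refine h.congr fun z hz => ?_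
  rw [Function.comp_apply, thetaTwo_eq, thetaTwoAux_eq_jacobiTheta₂, ofComplex_apply_of_im_pos hz]

end ThetaConstants

/-! ### The group `Δ` -/

section DeltaGroup

open ModularGroup

/-- The upper triangular generator `(1 2; 0 1)` of `Δ`. -/
def upperTwo : SL(2, ℤ) := ⟨!![1, 2; 0, 1], by simp [Matrix.det_fin_two]⟩

/-- The lower triangular generator `(1 0; 2 1)` of `Δ`. -/
def lowerTwo : SL(2, ℤ) := ⟨!![1, 0; 2, 1], by simp [Matrix.det_fin_two]⟩

theorem coe_upperTwo : (upperTwo : Matrix (Fin 2) (Fin 2) ℤ) = !![1, 2; 0, 1] := rfl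

theorem coe_lowerTwo : (lowerTwo : Matrix (Fin 2) (Fin 2) ℤ) = !![1, 0; 2, 1] := rfl

theorem Delta_eq : Delta = Subgroup.closure {upperTwo, lowerTwo} := rfl

theorem upperTwo_mem_Delta : upperTwo ∈ Delta :=
  Subgroup.subset_closure (Set.mem_insert _ _)

theorem lowerTwo_mem_Delta : lowerTwo ∈ Delta :=
  Subgroup.subset_closure (Set.mem_insert_of_mem _ rfl)

theorem upperTwo_eq : upperTwo = T * T := by
  ext i j
  fin_cases i <;> fin_cases j <;>
    simp [coe_upperTwo, coe_T, Matrix.mul_apply, Fin.sum_univ_two]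

theorem lowerTwo_eq : lowerTwo = S * upperTwo⁻¹ * S⁻¹ := by
  ext i j
  fin_cases i <;> fin_cases j <;>
    simp [coe_lowerTwo, coe_upperTwo, coe_S, Matrix.SpecialLinearGroup.coe_inv,
      Matrix.adjugate_fin_two, Matrix.mul_apply, Fin.sum_univ_two]

theorem upperTwo_zpow (n : ℤ) : (upperTwo ^ n).1 = !![1, 2 * n; 0, 1] := by
  rw [upperTwo_eq, ← pow_two, ← zpow_natCast, ← zpow_mul, coe_T_zpow]
  norm_num

/-- The elements of `Δ` are congruent to the identity modulo `2`, and their diagonal entries are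
`1` modulo `4`. In particular `-1 ∉ Δ`. -/
theorem Delta_congruences {γ : SL(2, ℤ)} (hγ : γ ∈ Delta) :
    4 ∣ γ 0 0 - 1 ∧ 2 ∣ γ 0 1 ∧ 2 ∣ γ 1 0 ∧ 4 ∣ γ 1 1 - 1 := by
  rw [Delta_eq] at hγ
  induction hγ using Subgroup.closure_induction with
  | mem x hx =>
    rcases hx with rfl | rfl
    · simp [upperTwo]
    · simp [lowerTwo]
  | one => simp
  | mul x y _ _ hx hy =>
    obtain ⟨⟨a, ha⟩, ⟨b, hb⟩, ⟨c, hc⟩, ⟨d, hd⟩⟩ := hx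
    obtain ⟨⟨a', ha'⟩, ⟨b', hb'⟩, ⟨c', hc'⟩, ⟨d', hd'⟩⟩ := hy
    simp only [Matrix.SpecialLinearGroup.coe_mul, Matrix.mul_apply, Fin.sum_univ_two]
    rw [sub_eq_iff_eq_add] at ha hd ha' hd'
    rw [ha, hb, hc, hd, ha', hb', hc', hd']
    exact ⟨⟨4 * a * a' + a + a' + b * c', by ring⟩, ⟨(4 * a + 1) * b' + b * (4 * d' + 1), by ring⟩,
      ⟨c * (4 * a' + 1) + (4 * d + 1) * c', by ring⟩, ⟨4 * d * d' + d + d' + c * b', by ring⟩⟩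
  | inv x _ hx =>
    simpa [Matrix.SpecialLinearGroup.coe_inv, Matrix.adjugate_fin_two, and_comm, and_assoc,
      and_left_comm] using hx

/-- A matrix congruent to the identity modulo `2` lies in `Δ` up to sign, by Euclid's algorithm with
even quotients on its first column. -/
theorem mem_Delta_or_neg_mem {γ : SL(2, ℤ)} (h00 : ¬ 2 ∣ γ 0 0) (h01 : 2 ∣ γ 0 1)
    (h10 : 2 ∣ γ 1 0) : γ ∈ Delta ∨ -γ ∈ Delta := by
  induction hn : (γ 0 0).natAbs + (γ 1 0).natAbs using Nat.strong_induction_on generalizing γ with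
  | _ n ih =>
  have hdet : γ 0 0 * γ 1 1 - γ 0 1 * γ 1 0 = 1 := by
    have := γ.2
    rwa [Matrix.det_fin_two] at this
  have h11 : ¬ 2 ∣ γ 1 1 := by
    rintro ⟨d, hd⟩
    obtain ⟨b, hb⟩ := h01
    rw [hd, hb] at hdet
    have : (2 : ℤ) * (γ 0 0 * d - b * γ 1 0) = 1 := by linarith
    omega
  have step (g : SL(2, ℤ)) (hg : g ∈ Delta) (h : g * γ ∈ Delta ∨ -(g * γ) ∈ Delta) :
      γ ∈ Delta ∨ -γ ∈ Delta := by
    refine h.imp (fun h => (Subgroup.mul_mem_cancel_left _ hg).mp h) fun h => ?_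
    rw [← mul_neg] at h
    exact (Subgroup.mul_mem_cancel_left _ hg).mp h
  have upper (m : ℤ) : (upperTwo ^ m * γ) 0 0 = γ 0 0 + 2 * m * γ 1 0 ∧
      (upperTwo ^ m * γ) 0 1 = γ 0 1 + 2 * m * γ 1 1 ∧ (upperTwo ^ m * γ) 1 0 = γ 1 0 := by
    rw [Matrix.SpecialLinearGroup.coe_mul, upperTwo_zpow]
    simp [Matrix.mul_apply, Fin.sum_univ_two]
  have lower : (lowerTwo * γ) 0 0 = γ 0 0 ∧ (lowerTwo * γ) 0 1 = γ 0 1 ∧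
      (lowerTwo * γ) 1 0 = γ 1 0 + 2 * γ 0 0 := by
    simp [coe_lowerTwo, Matrix.mul_apply, Fin.sum_univ_two, add_comm]
  have lower' : (lowerTwo⁻¹ * γ) 0 0 = γ 0 0 ∧ (lowerTwo⁻¹ * γ) 0 1 = γ 0 1 ∧
      (lowerTwo⁻¹ * γ) 1 0 = γ 1 0 - 2 * γ 0 0 := by
    simp [coe_lowerTwo, Matrix.SpecialLinearGroup.coe_inv, Matrix.adjugate_fin_two,
      Matrix.mul_apply, Fin.sum_univ_two]
    ring
  by_cases hc : γ 1 0 = 0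
  · rw [hc, mul_zero, sub_zero] at hdet
    obtain ⟨b, hb⟩ := h01
    rcases Int.eq_one_or_neg_one_of_mul_eq_one hdet with h | h
    · have hd : γ 1 1 = 1 := by rw [h] at hdet; linarith
      left
      convert Subgroup.zpow_mem _ upperTwo_mem_Delta b
      apply Subtype.ext
      rw [upperTwo_zpow]
      ext i j
      fin_cases i <;> fin_cases j <;> simp [h, hd, hc, hb]
    · have hd : γ 1 1 = -1 := by rw [h] at hdet; linarith
      right
      convert Subgroup.zpow_mem _ upperTwo_mem_Delta (-b)
      apply Subtype.ext
      rw [upperTwo_zpow]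
      ext i j
      fin_cases i <;> fin_cases j <;> simp [h, hd, hc, hb]
  · rcases lt_or_gt_of_ne (show (γ 0 0).natAbs ≠ (γ 1 0).natAbs by omega) with hlt | hlt
    · have h0 : γ 0 0 ≠ 0 := fun h => h00 (h ▸ dvd_zero _)
      have hred : (γ 1 0 + 2 * γ 0 0).natAbs < (γ 1 0).natAbs ∨
          (γ 1 0 - 2 * γ 0 0).natAbs < (γ 1 0).natAbs := by omega
      rcases hred with h | h
      · refine step _ lowerTwo_mem_Delta (ih _ ?_ ?_ ?_ ?_ rfl)
        · rw [lower.1, lower.2.2]; omega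
        · rw [lower.1]; exact h00
        · rw [lower.2.1]; exact h01
        · rw [lower.2.2]; omega
      · refine step _ (inv_mem lowerTwo_mem_Delta) (ih _ ?_ ?_ ?_ ?_ rfl)
        · rw [lower'.1, lower'.2.2]; omega
        · rw [lower'.1]; exact h00
        · rw [lower'.2.1]; exact h01
        · rw [lower'.2.2]; omega
    · have hred : ∃ m : ℤ, (γ 0 0 + 2 * m * γ 1 0).natAbs < (γ 0 0).natAbs := by
        have : (γ 0 0 + 2 * γ 1 0).natAbs < (γ 0 0).natAbs ∨
          (γ 0 0 - 2 * γ 1 0).natAbs < (γ 0 0).natAbs := by omega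
        rcases this with h | h
        · exact ⟨1, by simpa using h⟩
        · exact ⟨-1, by simpa [sub_eq_add_neg] using h⟩
      obtain ⟨m, hm⟩ := hred
      refine step _ (Subgroup.zpow_mem _ upperTwo_mem_Delta m) (ih _ ?_ ?_ ?_ ?_ rfl)
      · rw [(upper m).1, (upper m).2.2]; omega
      · rw [(upper m).1, mul_assoc, Int.dvd_add_left (Dvd.intro _ rfl)]; exact h00
      · rw [(upper m).2.1, mul_assoc]; exact dvd_add h01 (Dvd.intro _ rfl)
      · rw [(upper m).2.2]; exact h10

theorem mem_Delta_or_neg_mem_of_mem_Gamma {γ : SL(2, ℤ)} (hγ : γ ∈ CongruenceSubgroup.Gamma 2) :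
    γ ∈ Delta ∨ -γ ∈ Delta := by
  obtain ⟨h0, h1, h2, -⟩ := CongruenceSubgroup.Gamma_mem.mp hγ
  refine mem_Delta_or_neg_mem (fun h => ?_) ?_ ?_
  · rw [← Nat.cast_ofNat, ← ZMod.intCast_zmod_eq_zero_iff_dvd, h0] at h
    exact one_ne_zero h
  · exact_mod_cast (ZMod.intCast_zmod_eq_zero_iff_dvd _ 2).mp h1
  · exact_mod_cast (ZMod.intCast_zmod_eq_zero_iff_dvd _ 2).mp h2

theorem Gamma_four_le_Delta : CongruenceSubgroup.Gamma 4 ≤ Delta := by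
  intro γ hγ
  obtain ⟨h0, h1, h2, -⟩ := CongruenceSubgroup.Gamma_mem.mp hγ
  have h0' : (4 : ℤ) ∣ γ 0 0 - 1 := by
    have : ((γ 0 0 - 1 : ℤ) : ZMod 4) = 0 := by push_cast; rw [h0, sub_self]
    exact_mod_cast (ZMod.intCast_zmod_eq_zero_iff_dvd _ 4).mp this
  have h1' : (4 : ℤ) ∣ γ 0 1 := by
    exact_mod_cast (ZMod.intCast_zmod_eq_zero_iff_dvd _ 4).mp h1
  have h2' : (4 : ℤ) ∣ γ 1 0 := by
    exact_mod_cast (ZMod.intCast_zmod_eq_zero_iff_dvd _ 4).mp h2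
  refine (mem_Delta_or_neg_mem (γ := γ) (by omega) (by omega) (by omega)).resolve_right fun h => ?_
  have := (Delta_congruences h).1
  simp only [Matrix.SpecialLinearGroup.coe_neg, Matrix.neg_apply] at this
  omega

instance finiteIndex_Delta : Delta.FiniteIndex :=
  Subgroup.finiteIndex_of_le Gamma_four_le_Delta

/-- The translations by `2` at the cusp `γ ∞` lie in `Δ` up to sign. -/
theorem conj_upperTwo_mem (γ : SL(2, ℤ)) :
    γ * upperTwo * γ⁻¹ ∈ Delta ∨ -(γ * upperTwo * γ⁻¹) ∈ Delta := by
  refine mem_Delta_or_neg_mem_of_mem_Gamma ?_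
  refine (CongruenceSubgroup.Gamma_normal 2).conj_mem _ ?_ γ
  rw [CongruenceSubgroup.Gamma_mem]
  simp [upperTwo]
  decide

end DeltaGroup

/-! ### Products of theta constants -/

section ThetaProducts

open ModularGroup Filter Topology

/-- The theta product `θ₂^{2a} θ₃^{2b} θ₄^{2c}`, of weight `a + b + c`. -/
noncomputable def thetaMono (a b c : ℤ) (τ : ℍ) : ℂ :=
  (thetaTwo τ ^ 2) ^ a * (thetaThree τ ^ 2) ^ b * (thetaFour τ ^ 2) ^ c

theorem thetaMono_ne_zero (a b c : ℤ) (τ : ℍ) : thetaMono a b c τ ≠ 0 :=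
  mul_ne_zero (mul_ne_zero (zpow_ne_zero _ (pow_ne_zero _ (thetaTwo_ne_zero τ)))
    (zpow_ne_zero _ (pow_ne_zero _ (thetaThree_ne_zero τ))))
    (zpow_ne_zero _ (pow_ne_zero _ (thetaFour_ne_zero τ)))

theorem mdifferentiable_zpow {F : ℍ → ℂ} (hF : MDiff F) (h0 : ∀ τ, F τ ≠ 0) (n : ℤ) :
    MDiff (fun τ => (F τ) ^ n) := by
  rw [mdifferentiable_iff] at hF ⊢
  exact DifferentiableOn.zpow (f := F ∘ ofComplex) hF (Or.inl fun z _ => h0 _)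

theorem mdifferentiable_thetaMono (a b c : ℤ) : MDiff (thetaMono a b c) :=
  ((mdifferentiable_zpow (mdifferentiable_thetaTwo.pow 2)
    (fun τ => pow_ne_zero _ (thetaTwo_ne_zero τ)) a).mul
    (mdifferentiable_zpow (mdifferentiable_thetaThree.pow 2)
    (fun τ => pow_ne_zero _ (thetaThree_ne_zero τ)) b)).mul
    (mdifferentiable_zpow (mdifferentiable_thetaFour.pow 2)
    (fun τ => pow_ne_zero _ (thetaFour_ne_zero τ)) c)

theorem thetaMono_slash_S {k a b c : ℤ} (hk : a + b + c = k) :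
    thetaMono a b c ∣[k] S = ((-I) ^ k : ℂ) • thetaMono c b a := by
  ext τ
  have hτ : (τ : ℂ) ≠ 0 := τ.ne_zero
  have hI : (-I : ℂ) ≠ 0 := neg_ne_zero.mpr I_ne_zero
  rw [ModularForm.SL_slash_apply, denom_S, Pi.smul_apply, smul_eq_mul, thetaMono, thetaMono,
    thetaTwo_S_smul_sq, thetaThree_S_smul_sq, thetaFour_S_smul_sq, ← hk]
  simp only [mul_zpow, zpow_neg, zpow_add₀ hτ, zpow_add₀ hI]
  field_simp

theorem denom_T (τ : ℍ) : denom T τ = 1 := by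
  rw [denom_apply]
  simp [coe_T]

theorem thetaMono_slash_T {k a b c : ℤ} :
    thetaMono a b c ∣[k] T = (I ^ a : ℂ) • thetaMono a c b := by
  ext τ
  rw [ModularForm.SL_slash_apply, denom_T, Pi.smul_apply, smul_eq_mul, thetaMono, thetaMono,
    thetaTwo_T_smul_sq, thetaThree_T_smul, thetaFour_T_smul, mul_zpow, one_zpow]
  ring

theorem slash_inv_eq {k : ℤ} {F G : ℍ → ℂ} {ζ : ℂ} {γ : SL(2, ℤ)} (hζ : ζ ≠ 0)
    (h : F ∣[k] γ = ζ • G) : G ∣[k] γ⁻¹ = ζ⁻¹ • F := by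
  have h1 : G = ζ⁻¹ • (F ∣[k] γ) := by rw [h, smul_smul, inv_mul_cancel₀ hζ, one_smul]
  rw [h1, ModularForm.SL_smul_slash, ← SlashAction.slash_mul, mul_inv_cancel, SlashAction.slash_one]

/-- `SL₂(ℤ)` permutes the theta products up to nonzero constants, through its action on the
exponents by permutations. -/
theorem exists_thetaMono_slash {k : ℤ} (R : ℤ → ℤ → ℤ → Prop)
    (hk : ∀ a b c, R a b c → a + b + c = k) (hS : ∀ a b c, R a b c → R c b a)
    (hT : ∀ a b c, R a b c → R a c b) (γ : SL(2, ℤ)) {a b c : ℤ} (h : R a b c) :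
    ∃ ζ : ℂ, ζ ≠ 0 ∧ ∃ a' b' c' : ℤ, R a' b' c' ∧
      thetaMono a b c ∣[k] γ = ζ • thetaMono a' b' c' := by
  have hγ : γ ∈ Subgroup.closure ({S, T} : Set SL(2, ℤ)) := by
    rw [SpecialLinearGroup.SL2Z_generators]
    exact Subgroup.mem_top γ
  have hI : (-I : ℂ) ≠ 0 := neg_ne_zero.mpr I_ne_zero
  induction hγ using Subgroup.closure_induction_right with
  | one => exact ⟨1, one_ne_zero, a, b, c, h, by rw [SlashAction.slash_one, one_smul]⟩
  | mul_right x _ y hy ih =>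
    obtain ⟨ζ, hζ, a', b', c', h', e⟩ := ih
    rw [SlashAction.slash_mul, e, ModularForm.SL_smul_slash]
    rcases hy with rfl | rfl
    · exact ⟨ζ * (-I) ^ k, mul_ne_zero hζ (zpow_ne_zero _ hI), c', b', a', hS _ _ _ h', by
        rw [thetaMono_slash_S (hk _ _ _ h'), smul_smul]⟩
    · exact ⟨ζ * I ^ a', mul_ne_zero hζ (zpow_ne_zero _ I_ne_zero), a', c', b', hT _ _ _ h', by
        rw [thetaMono_slash_T, smul_smul]⟩
  | mul_inv_cancel x _ y hy ih =>
    obtain ⟨ζ, hζ, a', b', c', h', e⟩ := ih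
    rw [SlashAction.slash_mul, e, ModularForm.SL_smul_slash]
    rcases hy with rfl | rfl
    · exact ⟨ζ * ((-I) ^ k)⁻¹, mul_ne_zero hζ (inv_ne_zero (zpow_ne_zero _ hI)), c', b', a',
        hS _ _ _ h', by
        rw [slash_inv_eq (zpow_ne_zero _ hI) (thetaMono_slash_S (hk _ _ _ (hS _ _ _ h'))),
          smul_smul]⟩
    · exact ⟨ζ * (I ^ a')⁻¹, mul_ne_zero hζ (inv_ne_zero (zpow_ne_zero _ I_ne_zero)), a', c', b',
        hT _ _ _ h', by
        rw [slash_inv_eq (zpow_ne_zero _ I_ne_zero) thetaMono_slash_T, smul_smul]⟩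

theorem thetaMono_slash_upperTwo {k a b c : ℤ} :
    thetaMono a b c ∣[k] upperTwo = ((-1) ^ a : ℂ) • thetaMono a b c := by
  rw [upperTwo_eq, SlashAction.slash_mul, thetaMono_slash_T, ModularForm.SL_smul_slash,
    thetaMono_slash_T, smul_smul, ← mul_zpow, I_mul_I]

theorem thetaMono_slash_Delta {k a b c : ℤ} (hk : a + b + c = k) (ha : Even a) (hc : Even c)
    {γ : SL(2, ℤ)} (hγ : γ ∈ Delta) : thetaMono a b c ∣[k] γ = thetaMono a b c := by
  have hI : ((-I) ^ k : ℂ) ≠ 0 := zpow_ne_zero _ (neg_ne_zero.mpr I_ne_zero)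
  rw [Delta_eq] at hγ
  induction hγ using Subgroup.closure_induction with
  | mem x hx =>
    rcases hx with rfl | rfl
    · rw [thetaMono_slash_upperTwo, ha.neg_one_zpow, one_smul]
    · have h1 : thetaMono c b a ∣[k] upperTwo = (1 : ℂ) • thetaMono c b a := by
        rw [thetaMono_slash_upperTwo, hc.neg_one_zpow]
      rw [lowerTwo_eq, SlashAction.slash_mul, SlashAction.slash_mul, thetaMono_slash_S hk,
        ModularForm.SL_smul_slash, ModularForm.SL_smul_slash, slash_inv_eq one_ne_zero h1, inv_one,
        one_smul, slash_inv_eq hI (thetaMono_slash_S hk), smul_smul, mul_inv_cancel₀ hI, one_smul]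
  | one => exact SlashAction.slash_one _ _
  | mul x y _ _ hx hy => rw [SlashAction.slash_mul, hx, hy]
  | inv x _ hx =>
    have := slash_inv_eq (ζ := 1) one_ne_zero (hx.trans (one_smul ℂ _).symm)
    rwa [inv_one, one_smul] at this

/-! ### Behaviour at the cusps -/

/-- The square root `exp (π i τ / 2)` of the nome. -/
noncomputable def sqrtNome (τ : ℍ) : ℂ := cexp (Real.pi * I * τ / 2)

theorem sqrtNome_ne_zero (τ : ℍ) : sqrtNome τ ≠ 0 := Complex.exp_ne_zero _

theorem norm_sqrtNome (τ : ℍ) : ‖sqrtNome τ‖ = Real.exp (-(Real.pi / 2) * τ.im) := by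
  rw [sqrtNome, Complex.norm_exp]
  congr 1
  simp
  ring

theorem sqrtNome_pow_four (τ : ℍ) : sqrtNome τ ^ 4 = cexp (2 * Real.pi * I * τ) := by
  rw [sqrtNome, ← Complex.exp_nat_mul]
  push_cast
  ring_nf

theorem tendsto_sqrtNome : Tendsto sqrtNome atImInfty (𝓝 0) := by
  rw [tendsto_zero_iff_norm_tendsto_zero]
  simp only [norm_sqrtNome]
  refine Real.tendsto_exp_atBot.comp ?_
  have : Tendsto UpperHalfPlane.im atImInfty atTop := tendsto_comap
  exact this.const_mul_atTop_of_neg (by have := Real.pi_pos; linarith)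

theorem thetaTwo_sq_eq (τ : ℍ) : thetaTwo τ ^ 2 = sqrtNome τ * thetaTwoAux τ ^ 2 := by
  rw [thetaTwo_eq, mul_pow, sqrtNome, ← Complex.exp_nat_mul]
  push_cast
  ring_nf

/-- The leading coefficient of `θ₂^{2a} θ₃^{2b} θ₄^{2c}` at `i∞` is `4 ^ a`, and its order there is
`a / 2` as a power of `q = exp (π i τ)`. -/
theorem tendsto_thetaMono_div (a b c : ℤ) :
    Tendsto (fun τ => thetaMono a b c τ / sqrtNome τ ^ a) atImInfty (𝓝 (4 ^ a)) := by
  have h2 : Tendsto (fun τ => thetaTwoAux τ) atImInfty (𝓝 2) := by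
    have := hasQExp_thetaTwoAux.tendsto.const_mul 2
    rw [isLandenTriple_theta.const_psi, mul_one] at this
    exact this.congr fun τ => by ring
  have h3 := hasQExp_thetaThree.tendsto
  have h4 := hasQExp_thetaFour.tendsto
  rw [isLandenTriple_theta.const_phi] at h3
  rw [isLandenTriple_theta.const_v] at h4
  have := (((h2.pow 2).zpow₀ a (Or.inl (by norm_num))).mul
    ((h3.pow 2).zpow₀ b (Or.inl (by norm_num)))).mul ((h4.pow 2).zpow₀ c (Or.inl (by norm_num)))
  norm_num at this
  refine this.congr fun τ => ?_
  rw [thetaMono, thetaTwo_sq_eq, mul_zpow]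
  have := zpow_ne_zero a (sqrtNome_ne_zero τ)
  field_simp

theorem tendsto_sqrtNome_zpow {n : ℤ} (hn : 0 < n) :
    Tendsto (fun τ => sqrtNome τ ^ n) atImInfty (𝓝 0) := by
  lift n to ℕ using hn.le
  have := tendsto_sqrtNome.pow n
  rw [zero_pow (by omega)] at this
  simpa using this

theorem isZeroAtImInfty_thetaMono {a : ℤ} (b c : ℤ) (ha : 0 < a) :
    IsZeroAtImInfty (thetaMono a b c) := by
  have := (tendsto_thetaMono_div a b c).mul (tendsto_sqrtNome_zpow ha)
  rw [mul_zero] at this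
  exact this.congr fun τ => div_mul_cancel₀ _ (zpow_ne_zero a (sqrtNome_ne_zero τ))

end ThetaProducts

/-! ### Forms for `Δ` -/

section FormsForDelta

open ModularGroup Filter Topology

theorem thetaTwo_pow_four (τ : ℍ) :
    thetaTwo τ ^ 4 = 16 * (nome τ * (thetaTwoAux τ / 2) ^ 4) := by
  have hq : cexp (Real.pi * I * τ / 4) ^ 4 = nome τ := by
    rw [nome, ← Complex.exp_nat_mul]
    push_cast
    ring_nf
  rw [thetaTwo_eq, mul_pow, hq]
  ring

/-- Jacobi's identity, a consequence of Landen's transformation. -/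
theorem thetaFour_pow_four (τ : ℍ) :
    thetaFour τ ^ 4 = thetaThree τ ^ 4 - thetaTwo τ ^ 4 := by
  have h2 := thetaTwoAux_sq τ
  have h3 := thetaThree_sq τ
  have h4 := thetaFour_sq τ
  rw [thetaTwo_pow_four, show (thetaTwoAux τ / 2) ^ 4 = (thetaTwoAux τ ^ 2) ^ 2 / 16 by ring, h2,
    show thetaFour τ ^ 4 = (thetaFour τ ^ 2) ^ 2 by ring, h4,
    show thetaThree τ ^ 4 = (thetaThree τ ^ 2) ^ 2 by ring, h3]
  ring

theorem one_sub_ell (τ : ℍ) : 1 - 16 * ell τ = thetaFour τ ^ 4 / thetaThree τ ^ 4 := by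
  have := thetaThree_ne_zero τ
  rw [thetaFour_pow_four, ell, modularLambda]
  field_simp

theorem f₁_eq : LambdaForms.f₁ = (1 / 16 : ℂ) • thetaMono 2 1 2 := by
  ext τ
  have := thetaThree_ne_zero τ
  rw [LambdaForms.f₁, one_sub_ell, ell, modularLambda, theta, Pi.smul_apply, smul_eq_mul, thetaMono]
  norm_cast
  field_simp

theorem g₁_eq : LambdaForms.g₁ = (1 / 256 : ℂ) • thetaMono 4 (-3) 4 := by
  ext τ
  have := thetaThree_ne_zero τ
  rw [LambdaForms.g₁, one_sub_ell, ell, modularLambda, theta, Pi.smul_apply, smul_eq_mul, thetaMono,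
    zpow_neg]
  norm_cast
  field_simp
  norm_num
  ring

/-- The exponents of the theta products in the `SL₂(ℤ)`-orbit of `f₁`. -/
def IsCuspExponent (a b c : ℤ) : Prop :=
  a + b + c = 5 ∧ (a = 1 ∨ a = 2) ∧ (b = 1 ∨ b = 2) ∧ (c = 1 ∨ c = 2)

theorem exists_f₁_slash (γ : SL(2, ℤ)) : ∃ ζ : ℂ, ζ ≠ 0 ∧ ∃ a b c : ℤ, IsCuspExponent a b c ∧
    LambdaForms.f₁ ∣[(5 : ℤ)] γ = ζ • thetaMono a b c := by
  obtain ⟨ζ, hζ, a, b, c, h, e⟩ := exists_thetaMono_slash (k := 5) IsCuspExponent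
    (fun _ _ _ h => h.1)
    (fun a b c h => ⟨by linarith [h.1], h.2.2.2, h.2.2.1, h.2.1⟩)
    (fun a b c h => ⟨by linarith [h.1], h.2.1, h.2.2.2, h.2.2.1⟩) γ (a := 2) (b := 1) (c := 2)
    ⟨by norm_num, by norm_num, by norm_num, by norm_num⟩
  exact ⟨1 / 16 * ζ, mul_ne_zero (by norm_num) hζ, a, b, c, h, by
    rw [f₁_eq, ModularForm.SL_smul_slash, e, smul_smul]⟩

theorem f₁_slash_Delta {γ : SL(2, ℤ)} (hγ : γ ∈ Delta) :
    LambdaForms.f₁ ∣[(5 : ℤ)] γ = LambdaForms.f₁ := by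
  rw [f₁_eq, ModularForm.SL_smul_slash,
    thetaMono_slash_Delta (by norm_num) (by decide) (by decide) hγ]

theorem f₁_ne_zero (τ : ℍ) : LambdaForms.f₁ τ ≠ 0 := by
  rw [f₁_eq]
  exact mul_ne_zero (by norm_num) (thetaMono_ne_zero _ _ _ τ)

theorem mdifferentiable_f₁ : MDiff LambdaForms.f₁ := by
  rw [f₁_eq]
  exact (mdifferentiable_thetaMono 2 1 2).const_smul _

theorem slash_eq_of_Delta {k : ℤ} {F : ℍ → ℂ} (hF : ∀ γ ∈ Delta, F ∣[k] γ = F) :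
    ∀ γ ∈ (Delta : Subgroup (GL (Fin 2) ℝ)), F ∣[k] γ = F := by
  rintro _ ⟨γ, hγ, rfl⟩
  exact hF γ hγ

/-- `f₁` as a cusp form. -/
noncomputable def cuspFormF₁ : CuspForm (Delta : Subgroup (GL (Fin 2) ℝ)) 5 where
  toFun := LambdaForms.f₁
  slash_action_eq' := slash_eq_of_Delta fun _ h => f₁_slash_Delta h
  holo' := mdifferentiable_f₁
  zero_at_cusps' hc := by
    rw [Subgroup.IsArithmetic.isCusp_iff_isCusp_SL2Z] at hc
    refine (OnePoint.isZeroAt_iff_forall_SL2Z hc).mpr fun γ _ => ?_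
    obtain ⟨ζ, -, a, b, c, h, e⟩ := exists_f₁_slash γ
    change IsZeroAtImInfty (LambdaForms.f₁ ∣[(5 : ℤ)] γ)
    rw [e]
    exact (isZeroAtImInfty_thetaMono b c (by rcases h.2.1 with h | h <;> omega)).smul ζ

theorem isWeaklyHolomorphic_g₁ : IsWeaklyHolomorphic Delta 5 LambdaForms.g₁ where
  holo := by
    rw [g₁_eq]
    exact (mdifferentiable_thetaMono 4 (-3) 4).const_smul _
  slash_eq γ hγ := by
    rw [g₁_eq, ModularForm.SL_smul_slash,
      thetaMono_slash_Delta (by norm_num) (by decide) (by decide) hγ]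
  meromorphic_at_cusps γ := by
    -- the order in `q` of each product in the orbit is at least `-3 / 2`, so `q ^ 2` suffices
    refine ⟨1, ?_⟩
    obtain ⟨ζ, -, a, b, c, h, e⟩ := exists_thetaMono_slash (k := 5)
      (fun a b c => a + b + c = 5 ∧ -3 ≤ a ∧ -3 ≤ b ∧ -3 ≤ c) (fun _ _ _ h => h.1)
      (fun a b c h => by omega) (fun a b c h => by omega) γ
      (a := 4) (b := -3) (c := 4) (by norm_num)
    have h1 := ((tendsto_thetaMono_div a b c).mul
      (tendsto_sqrtNome_zpow (n := 4 + a) (by omega))).const_mul (1 / 256 * ζ)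
    refine (h1.congr fun τ => ?_).isBigO_one ℝ
    rw [g₁_eq, ModularForm.SL_smul_slash, e, zpow_add₀ (sqrtNome_ne_zero τ), pow_one,
      ← sqrtNome_pow_four]
    have := zpow_ne_zero a (sqrtNome_ne_zero τ)
    simp only [Pi.smul_apply, smul_eq_mul]
    norm_cast
    field_simp

/-! ### The space of cusp forms of weight five -/

theorem slash_neg_eq (k : ℤ) (F : ℍ → ℂ) (γ : SL(2, ℤ)) :
    F ∣[k] (-γ) = ((-1) ^ k : ℂ) • (F ∣[k] γ) := by
  ext τ
  rw [ModularForm.SL_slash_apply, Pi.smul_apply, ModularForm.SL_slash_apply, SL_neg_smul,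
    smul_eq_mul]
  have : denom ((-γ : SL(2, ℤ)) : GL (Fin 2) ℝ) τ = -1 * denom (γ : GL (Fin 2) ℝ) τ := by
    simp [denom]
    ring
  have h2 : ((-1 : ℂ) ^ (-k)) = (-1) ^ k := by
    rw [zpow_neg, ← inv_zpow, inv_neg, inv_one]
  rw [this, mul_zpow, h2]
  ring

/-- At each cusp, translation by `2` acts on all forms of weight `5` for `Δ` through one and the
same sign. -/
theorem exists_sign_slash_upperTwo (γ : SL(2, ℤ)) : ∃ ε : ℂ, ε ^ 2 = 1 ∧
    ∀ F : ℍ → ℂ, (∀ δ ∈ Delta, F ∣[(5 : ℤ)] δ = F) →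
      (F ∣[(5 : ℤ)] γ) ∣[(5 : ℤ)] upperTwo = ε • (F ∣[(5 : ℤ)] γ) := by
  rcases conj_upperTwo_mem γ with h | h
  · refine ⟨1, one_pow 2, fun F hF => ?_⟩
    rw [one_smul, ← SlashAction.slash_mul, show γ * upperTwo = γ * upperTwo * γ⁻¹ * γ by group,
      SlashAction.slash_mul, hF _ h]
  · refine ⟨(-1) ^ (5 : ℤ), by norm_num, fun F hF => ?_⟩
    rw [← SlashAction.slash_mul,
      show γ * upperTwo = -(-(γ * upperTwo * γ⁻¹) * γ) by rw [neg_mul, neg_neg]; group,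
      slash_neg_eq, SlashAction.slash_mul, hF _ h]

theorem slash_upperTwo_apply (k : ℤ) (F : ℍ → ℂ) (τ : ℍ) :
    (F ∣[k] upperTwo) τ = F ((2 : ℝ) +ᵥ τ) := by
  rw [upperTwo_eq, SlashAction.slash_mul, ModularForm.SL_slash_apply, ModularForm.SL_slash_apply,
    denom_T, denom_T, one_zpow, mul_one, mul_one]
  congr 1
  ext
  rw [coe_T_smul, coe_T_smul, coe_vadd]
  push_cast
  ring

theorem periodic_comp_ofComplex {F : ℍ → ℂ} {h : ℝ} (hF : ∀ τ : ℍ, F (h +ᵥ τ) = F τ) :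
    Function.Periodic (F ∘ ofComplex) h := by
  intro w
  by_cases! hw : 0 < im w
  · have h2 : 0 < im (w + h) := by simpa using hw
    simp only [Function.comp_apply, ofComplex_apply_of_im_pos h2, ofComplex_apply_of_im_pos hw]
    rw [← hF ⟨w, hw⟩]
    congr 1
    ext
    rw [coe_vadd]
    exact add_comm w (h : ℂ)
  · have h2 : im (w + h) ≤ 0 := by simpa using hw
    simp [ofComplex_apply_of_im_nonpos h2, ofComplex_apply_of_im_nonpos hw]

/-- A cusp form of weight `5` vanishes at each cusp at least to the order of `f₁`. -/
theorem isBoundedAtImInfty_div_f₁ (G : CuspForm (Delta : Subgroup (GL (Fin 2) ℝ)) 5)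
    (γ : SL(2, ℤ)) :
    IsBoundedAtImInfty (((G : ℍ → ℂ) ∣[(5 : ℤ)] γ) / (LambdaForms.f₁ ∣[(5 : ℤ)] γ)) := by
  obtain ⟨ζ, hζ, a, b, c, h, e⟩ := exists_f₁_slash γ
  obtain ⟨ε, hε, hsign⟩ := exists_sign_slash_upperTwo γ
  set H : ℍ → ℂ := (G : ℍ → ℂ) ∣[(5 : ℤ)] γ with hH
  have hG : ∀ τ, H ((2 : ℝ) +ᵥ τ) = ε * H τ := fun τ => by
    rw [← slash_upperTwo_apply 5 H, hsign G fun δ hδ => G.slash_action_eq' _ ⟨δ, hδ, rfl⟩]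
    rfl
  have hf : ε = (-1) ^ a := by
    have h1 := congrFun (hsign _ fun δ hδ => f₁_slash_Delta hδ) UpperHalfPlane.I
    rw [e, ModularForm.SL_smul_slash, thetaMono_slash_upperTwo] at h1
    simp only [Pi.smul_apply, smul_eq_mul] at h1
    have h2 := mul_ne_zero hζ (thetaMono_ne_zero a b c UpperHalfPlane.I)
    exact mul_right_cancel₀ h2 (by linear_combination -h1)
  have hzero : IsZeroAtImInfty H := CuspFormClass.zero_at_infty_slash G γ
  have hdiff : MDiff H := MDifferentiable.slash G.holo' _ _
  -- `f₁` has order `a / 2` in `q` at this cusp, and `G` has a Fourier expansion in powers of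
  -- `q ^ (a / 2)` without constant term: it has period `2` if `a = 2`, and always period `4`
  have hdecay : H =O[atImInfty] fun τ => sqrtNome τ ^ a := by
    have key (p : ℝ) (hp : 0 < p) (ha : 4 = a * p) (hper : ∀ τ : ℍ, H (p +ᵥ τ) = H τ) :
        H =O[atImInfty] fun τ => sqrtNome τ ^ a := by
      refine (hzero.exp_decay_atImInfty hp (periodic_comp_ofComplex hper) hdiff
        hzero.isBoundedAtImInfty).trans (Asymptotics.IsBigO.of_norm_right ?_)
      refine (Asymptotics.isBigO_refl _ _).congr_right fun τ => ?_
      rw [norm_zpow, norm_sqrtNome, ← Real.rpow_intCast, ← Real.exp_mul]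
      congr 1
      field_simp
      linear_combination -ha
    rcases h.2.1 with rfl | rfl
    · refine key 4 (by norm_num) (by norm_num) fun τ => ?_
      have : (4 : ℝ) +ᵥ τ = (2 : ℝ) +ᵥ ((2 : ℝ) +ᵥ τ) := by rw [vadd_vadd]; norm_num
      rw [this, hG, hG, ← mul_assoc, ← pow_two, hε, one_mul]
    · refine key 2 (by norm_num) (by norm_num) fun τ => ?_
      rw [hG, hf]
      norm_num
  have hinv : (fun τ => (sqrtNome τ ^ a) / (ζ • thetaMono a b c) τ) =O[atImInfty]
      fun _ => (1 : ℝ) := by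
    have h4 : (ζ * 4 ^ a : ℂ) ≠ 0 := mul_ne_zero hζ (zpow_ne_zero _ (by norm_num))
    refine ((((tendsto_thetaMono_div a b c).const_mul ζ).inv₀ h4).congr fun τ => ?_).isBigO_one ℝ
    rw [Pi.smul_apply, smul_eq_mul, ← mul_div_assoc, inv_div]
  rw [e]
  have h1 := hdecay.mul
    (Asymptotics.isBigO_refl (fun τ => ((ζ • thetaMono a b c) τ)⁻¹) atImInfty)
  simp only [div_eq_mul_inv] at hinv
  exact h1.trans hinv

/-- The space of cusp forms of weight `5` is spanned by `f₁`. -/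
theorem exists_eq_smul_f₁ (G : CuspForm (Delta : Subgroup (GL (Fin 2) ℝ)) 5) :
    ∃ c : ℂ, ∀ τ, G τ = c * LambdaForms.f₁ τ := by
  let Q : ModularForm (Delta : Subgroup (GL (Fin 2) ℝ)) 0 :=
    { toFun := G / LambdaForms.f₁
      slash_action_eq' := slash_eq_of_Delta fun γ hγ => by
        have := ModularForm.div_slash_SL2 5 5 γ G LambdaForms.f₁
        rw [sub_self] at this
        rw [this, f₁_slash_Delta hγ]
        congr 1
        exact G.slash_action_eq' _ ⟨γ, hγ, rfl⟩
      holo' := MDifferentiable.div G.holo' mdifferentiable_f₁ f₁_ne_zero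
      bdd_at_cusps' := fun hc => by
        rw [Subgroup.IsArithmetic.isCusp_iff_isCusp_SL2Z] at hc
        refine (OnePoint.isBoundedAt_iff_forall_SL2Z hc).mpr fun γ _ => ?_
        have := ModularForm.div_slash_SL2 5 5 γ G LambdaForms.f₁
        rw [sub_self] at this
        change IsBoundedAtImInfty ((G / LambdaForms.f₁ : ℍ → ℂ) ∣[(0 : ℤ)] γ)
        rw [this]
        exact isBoundedAtImInfty_div_f₁ G γ }
  obtain ⟨c, hc⟩ := ModularForm.eq_const_of_weight_zero Q
  refine ⟨c, fun τ => ?_⟩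
  have : G τ / LambdaForms.f₁ τ = c := congrFun hc τ
  rwa [div_eq_iff (f₁_ne_zero τ)] at this

end FormsForDelta

/-! ### Gaussian integers -/

section GaussianIntegers

/-- The coordinates `(re, im)` of a Gaussian integer. -/
def gaussianCoords : GaussianInt ≃ₗ[ℤ] (Fin 2 → ℤ) where
  toFun z := ![z.re, z.im]
  invFun v := ⟨v 0, v 1⟩
  map_add' x y := by ext i; fin_cases i <;> simp
  map_smul' n x := by ext i; fin_cases i <;> simp
  left_inv z := rfl
  right_inv v := by ext i; fin_cases i <;> rfl

/-- The basis `1, i` of the Gaussian integers. -/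
noncomputable def gaussianBasis : Module.Basis (Fin 2) ℤ GaussianInt :=
  Module.Basis.ofEquivFun gaussianCoords

instance free_gaussianInt : Module.Free ℤ GaussianInt := Module.Free.of_basis gaussianBasis

instance finite_gaussianInt : Module.Finite ℤ GaussianInt := Module.Finite.of_basis gaussianBasis

theorem card_quotient_span (α : GaussianInt) :
    Nat.card (GaussianInt ⧸ Ideal.span {α}) = α.re.natAbs ^ 2 + α.im.natAbs ^ 2 := by
  rw [← Submodule.cardQuot_apply, ← Ideal.absNorm_apply, Ideal.absNorm_span_singleton,
    pow_two, pow_two, ← GaussianInt.natAbs_norm_eq, Algebra.norm_eq_matrix_det gaussianBasis,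
    Matrix.det_fin_two]
  have h0 : gaussianBasis 0 = 1 := by
    rw [gaussianBasis, Module.Basis.coe_ofEquivFun]
    rfl
  have h1 : gaussianBasis 1 = ⟨0, 1⟩ := by
    rw [gaussianBasis, Module.Basis.coe_ofEquivFun]
    rfl
  have hr (z : GaussianInt) : gaussianBasis.repr z 0 = z.re ∧ gaussianBasis.repr z 1 = z.im := by
    constructor <;> rw [gaussianBasis, Module.Basis.ofEquivFun_repr_apply] <;> rfl
  simp [Algebra.leftMulMatrix_eq_repr_mul, h0, h1, hr, Zsqrtd.norm_def]

/-- The units `1, -1, i, -i` of the Gaussian integers. -/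
def gaussianUnits : Finset GaussianInt := {1, -1, ⟨0, 1⟩, ⟨0, -1⟩}

theorem mem_gaussianUnits {u : GaussianInt} : u ∈ gaussianUnits ↔ IsUnit u := by
  rw [← Zsqrtd.norm_eq_one_iff, GaussianInt.natAbs_norm_eq]
  simp only [gaussianUnits, Finset.mem_insert, Finset.mem_singleton, Zsqrtd.ext_iff]
  constructor
  · rintro (⟨h, h'⟩ | ⟨h, h'⟩ | ⟨h, h'⟩ | ⟨h, h'⟩) <;> simp [h, h']
  · intro h
    simp only [Zsqrtd.re_one, Zsqrtd.im_one, Zsqrtd.re_neg, Zsqrtd.im_neg]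
    have h1 : u.re.natAbs ≤ 1 := by nlinarith
    have h2 : u.im.natAbs ≤ 1 := by nlinarith
    have h3 : u.re.natAbs = 0 ∨ u.re.natAbs = 1 := by omega
    have h4 : u.im.natAbs = 0 ∨ u.im.natAbs = 1 := by omega
    rcases h3 with h3 | h3 <;> rcases h4 with h4 | h4 <;> rw [h3, h4] at h <;> omega

theorem card_gaussianUnits : gaussianUnits.card = 4 := by decide

theorem toComplex_unit_pow_four {u : GaussianInt} (hu : IsUnit u) :
    GaussianInt.toComplex u ^ 4 = 1 := by
  rw [← mem_gaussianUnits] at hu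
  simp only [gaussianUnits, Finset.mem_insert, Finset.mem_singleton] at hu
  rcases hu with rfl | rfl | rfl | rfl <;>
    simp [GaussianInt.toComplex_def, Even.neg_pow (show Even 4 by decide)]

theorem card_generators {J : Ideal GaussianInt} (hJ : J ≠ ⊥) :
    Nat.card {α : GaussianInt // Ideal.span {α} = J} = 4 := by
  obtain ⟨g, rfl⟩ : ∃ g, Ideal.span {g} = J :=
    ⟨_, Ideal.span_singleton_generator J⟩
  have hg : g ≠ 0 := fun h => hJ (by rw [h, Ideal.span_singleton_eq_bot])
  rw [← card_gaussianUnits, ← Finset.card_image_of_injective _ (mul_right_injective₀ hg)]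
  refine Nat.subtype_card _ fun α => ?_
  simp only [Finset.mem_image, mem_gaussianUnits]
  rw [Ideal.span_singleton_eq_span_singleton, Associated.comm]
  exact ⟨fun ⟨u, hu, h⟩ => ⟨hu.unit, h⟩, fun ⟨u, h⟩ => ⟨u, u.isUnit, h⟩⟩

/-- The Hecke character `(α) ↦ α⁴` of conductor `1`; it is well defined since the units of `ℤ[i]`
are the fourth roots of unity. -/
noncomputable def heckeChar : Ideal GaussianInt →*₀ ℂ where
  toFun J := GaussianInt.toComplex (Submodule.IsPrincipal.generator J) ^ 4
  map_zero' := by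
    rw [(Submodule.IsPrincipal.eq_bot_iff_generator_eq_zero _).mp Submodule.zero_eq_bot]
    simp
  map_one' := by
    refine toComplex_unit_pow_four ?_
    rw [← Ideal.span_singleton_eq_top, Ideal.span_singleton_generator, Ideal.one_eq_top]
  map_mul' J K := by
    have h : Associated (Submodule.IsPrincipal.generator J * Submodule.IsPrincipal.generator K)
        (Submodule.IsPrincipal.generator (J * K)) := by
      rw [← Ideal.span_singleton_eq_span_singleton, ← Ideal.span_singleton_mul_span_singleton]
      simp only [Ideal.span_singleton_generator]
    obtain ⟨u, hu⟩ := h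
    rw [← hu, map_mul, map_mul, mul_pow, mul_pow, toComplex_unit_pow_four u.isUnit, mul_one]

theorem heckeChar_span (α : GaussianInt) :
    heckeChar (Ideal.span {α}) = GaussianInt.toComplex α ^ 4 := by
  have h : Associated α (Submodule.IsPrincipal.generator (Ideal.span {α})) := by
    rw [← Ideal.span_singleton_eq_span_singleton, Ideal.span_singleton_generator]
  obtain ⟨u, hu⟩ := h
  change GaussianInt.toComplex (Submodule.IsPrincipal.generator (Ideal.span {α})) ^ 4 = _
  rw [← hu, map_mul, mul_pow, toComplex_unit_pow_four u.isUnit, mul_one]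

theorem isHeckeCharacter_heckeChar : IsHeckeCharacter 4 ⊤ heckeChar where
  modulus_ne_bot := top_ne_bot
  eq_zero J hJ := (hJ (Ideal.isCoprime_iff_sup_eq.mpr (sup_top_eq J))).elim
  principal α _ _ := heckeChar_span α

/-- The prime ideals above a split prime. -/
theorem ideals_of_norm_eq_split {p : ℕ} (hp : p.Prime) {x y : ℤ} (hxy : (p : ℤ) = x ^ 2 + y ^ 2)
    (J : Ideal GaussianInt) : Nat.card (GaussianInt ⧸ J) = p ↔
      J = Ideal.span {⟨x, y⟩} ∨ J = Ideal.span {⟨x, -y⟩} := by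
  have hnorm : x.natAbs ^ 2 + y.natAbs ^ 2 = p := by
    zify
    rw [sq_abs, sq_abs, hxy]
  constructor
  · obtain ⟨α, rfl⟩ : ∃ α, Ideal.span {α} = J := ⟨_, Ideal.span_singleton_generator J⟩
    intro h
    rw [card_quotient_span] at h
    have hα : (p : ℤ) = α.re ^ 2 + α.im ^ 2 := by
      rw [← h]
      push_cast
      rw [sq_abs, sq_abs]
    -- an element whose norm is a prime number is irreducible
    have hirr (π : GaussianInt) (hπ : π.norm.natAbs = p) : Prime π := by
      refine Irreducible.prime ⟨fun hu => ?_, fun a b hab => ?_⟩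
      · rw [Zsqrtd.norm_eq_one_iff.mpr hu] at hπ
        exact hp.one_lt.ne hπ
      · rw [hab, Zsqrtd.norm_mul, Int.natAbs_mul] at hπ
        rw [← Zsqrtd.norm_eq_one_iff, ← Zsqrtd.norm_eq_one_iff]
        have h1 : Prime (a.norm.natAbs * b.norm.natAbs) := by rw [hπ]; exact hp.prime
        have := h1.irreducible.isUnit_or_isUnit rfl
        rwa [Nat.isUnit_iff, Nat.isUnit_iff] at this
    have hassoc (π : GaussianInt) (hπ : π.norm.natAbs = p) (hd : π ∣ α) :
        Ideal.span {α} = Ideal.span {π} := by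
      obtain ⟨β, hβ⟩ := hd
      have h2 : α.norm.natAbs = p := by
        rw [GaussianInt.natAbs_norm_eq, ← h, pow_two, pow_two]
      rw [hβ, Zsqrtd.norm_mul, Int.natAbs_mul, hπ] at h2
      have h3 : β.norm.natAbs = 1 := by
        exact Nat.eq_of_mul_eq_mul_left hp.pos (by rw [h2, mul_one])
      rw [hβ, Ideal.span_singleton_mul_right_unit (Zsqrtd.norm_eq_one_iff.mp h3)]
    have hπ : (⟨x, y⟩ : GaussianInt).norm.natAbs = p := by
      rw [GaussianInt.natAbs_norm_eq, ← hnorm, pow_two, pow_two]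
    have hπ' : (⟨x, -y⟩ : GaussianInt).norm.natAbs = p := by
      rw [GaussianInt.natAbs_norm_eq, ← hnorm, pow_two, pow_two]
      simp
    have hdvd : (⟨x, y⟩ : GaussianInt) ∣ α * star α := by
      refine ⟨⟨x, -y⟩, ?_⟩
      rw [Zsqrtd.ext_iff]
      simp
      constructor
      · linear_combination -hα + hxy
      · ring
    rcases (hirr _ hπ).dvd_or_dvd hdvd with hd | hd
    · exact Or.inl (hassoc _ hπ hd)
    · refine Or.inr (hassoc _ hπ' ?_)
      obtain ⟨β, hβ⟩ := hd
      refine ⟨star β, ?_⟩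
      rw [← star_star α, hβ, star_mul', Zsqrtd.star_mk]
  · rintro (rfl | rfl) <;> rw [card_quotient_span, ← hnorm]
    simp

theorem span_ne_span_conj {p : ℕ} (hp : p.Prime) (hp2 : 2 < p) {x y : ℤ}
    (hxy : (p : ℤ) = x ^ 2 + y ^ 2) :
    Ideal.span {(⟨x, y⟩ : GaussianInt)} ≠ Ideal.span {⟨x, -y⟩} := by
  have hsq (z : ℤ) : (p : ℤ) ≠ z ^ 2 := fun h => by
    have h1 : p = z.natAbs ^ 2 := by zify; rw [sq_abs, h]
    rw [h1] at hp
    exact Nat.Prime.not_prime_pow le_rfl hp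
  have heven (z : ℤ) : (p : ℤ) ≠ 2 * z ^ 2 := fun h => by
    have h1 : 2 ∣ p := by
      have : (2 : ℤ) ∣ p := ⟨_, h⟩
      exact_mod_cast this
    rcases (Nat.dvd_prime hp).mp h1 with h | h <;> omega
  rw [Ne, Ideal.span_singleton_eq_span_singleton]
  rintro ⟨u, hu⟩
  have hmem := mem_gaussianUnits.mpr u.isUnit
  simp only [gaussianUnits, Finset.mem_insert, Finset.mem_singleton] at hmem
  rcases hmem with h | h | h | h <;> rw [h, Zsqrtd.ext_iff] at hu <;> simp at hu
  · exact hsq x (by rw [hxy, show y = 0 by omega]; ring)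
  · exact hsq y (by rw [hxy, show x = 0 by omega]; ring)
  · exact heven x (by rw [hxy, show y = -x by omega]; ring)
  · exact heven x (by rw [hxy, show y = x by omega]; ring)

theorem no_ideal_of_norm_eq_inert {p : ℕ} (hp : p % 4 = 3) (J : Ideal GaussianInt) :
    Nat.card (GaussianInt ⧸ J) ≠ p := by
  obtain ⟨α, rfl⟩ : ∃ α, Ideal.span {α} = J := ⟨_, Ideal.span_singleton_generator J⟩
  rw [card_quotient_span]
  rintro rfl
  have h (n : ℕ) : n ^ 2 % 4 = 0 ∨ n ^ 2 % 4 = 1 := by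
    rcases Nat.even_or_odd' n with ⟨k, rfl | rfl⟩
    · left; ring_nf; omega
    · right; ring_nf; omega
  have h1 := h α.re.natAbs
  have h2 := h α.im.natAbs
  omega

end GaussianIntegers

/-! ### Complex multiplication of `f₁` -/

section ComplexMultiplication

open PowerSeries Filter Topology

theorem ell_eq (τ : ℍ) : ell τ = nome τ * (thetaTwoAux τ / 2) ^ 4 / thetaThree τ ^ 4 := by
  rw [ell, modularLambda, thetaTwo_pow_four]
  ring

theorem f₁_eq_theta (τ : ℍ) : LambdaForms.f₁ τ =
    nome τ * (thetaTwoAux τ / 2) ^ 4 * thetaThree τ ^ 2 * thetaFour τ ^ 4 := by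
  have := thetaThree_ne_zero τ
  rw [LambdaForms.f₁, one_sub_ell, ell_eq, theta]
  field_simp

theorem hasQExp_f₁ :
    HasQExp LambdaForms.f₁ (X * psiSeries ^ 4 * phiSeries ^ 2 * vSeries ^ 4) := by
  have := ((HasQExp.X.mul (hasQExp_thetaTwoAux.pow 4)).mul (hasQExp_thetaThree.pow 2)).mul
    (hasQExp_thetaFour.pow 4)
  rwa [show LambdaForms.f₁ = _ from funext f₁_eq_theta]

theorem summable_pow_mul_nome (k : ℕ) (τ : ℍ) :
    Summable fun n : ℤ => (n : ℂ) ^ k * nome τ ^ n.natAbs ^ 2 := by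
  refine Summable.of_norm
    ((summable_pow_mul_jacobiTheta₂_term_bound 0 τ.im_pos k).congr fun n => ?_)
  rw [norm_mul, norm_pow, norm_pow, norm_nome, Complex.norm_intCast, Int.cast_abs,
    ← Real.exp_nat_mul]
  push_cast
  rw [Nat.cast_natAbs, Int.cast_abs, sq_abs]
  ring_nf

/-- The series `∑ nᵏ q^{n²}`. -/
noncomputable def thetaMoment (k : ℕ) (τ : ℍ) : ℂ := ∑' n : ℤ, (n : ℂ) ^ k * nome τ ^ n.natAbs ^ 2

theorem hasSum_thetaMoment (k : ℕ) (τ : ℍ) :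
    HasSum (fun n : ℤ => (n : ℂ) ^ k * nome τ ^ n.natAbs ^ 2) (thetaMoment k τ) :=
  (summable_pow_mul_nome k τ).hasSum

theorem hasQExp_thetaMoment (k : ℕ) :
    HasQExp (thetaMoment k) (genSeries (fun n : ℤ => (n : ℂ) ^ k) fun n => n.natAbs ^ 2) :=
  hasQExp_genSeries fun τ => hasSum_thetaMoment k τ

theorem natAbs_sq_cast (n : ℤ) : ((n.natAbs ^ 2 : ℕ) : ℂ) = (n : ℂ) ^ 2 := by
  rw [← Int.cast_natCast]
  push_cast
  rw [← Int.cast_pow, sq_abs, Int.cast_pow]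

theorem hasQExp_thetaMoment_zero : HasQExp (thetaMoment 0) phiSeries := by
  simpa [phiSeries] using hasQExp_thetaMoment 0

theorem hasQExp_thetaMoment_two : HasQExp (thetaMoment 2) (eulerD phiSeries) := by
  rw [phiSeries, eulerD_genSeries]
  simpa only [natAbs_sq_cast, mul_one] using hasQExp_thetaMoment 2

theorem hasQExp_thetaMoment_four : HasQExp (thetaMoment 4) (eulerD (eulerD phiSeries)) := by
  rw [phiSeries, eulerD_genSeries, eulerD_genSeries]
  simpa only [natAbs_sq_cast, mul_one, ← pow_add] using hasQExp_thetaMoment 4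

theorem thetaMoment_odd {k : ℕ} (hk : Odd k) (τ : ℍ) : thetaMoment k τ = 0 := by
  have h1 := (Equiv.neg ℤ).hasSum_iff.mpr (hasSum_thetaMoment k τ)
  have h2 := (hasSum_thetaMoment k τ).neg
  have h3 := h2.unique (h1.congr_fun fun n => by simp [hk.neg_pow])
  linear_combination -(1 / 2 : ℂ) * h3

/-- The Gaussian integers as pairs of integers. -/
def gaussianPair : ℤ × ℤ ≃ GaussianInt where
  toFun p := ⟨p.1, p.2⟩
  invFun z := (z.re, z.im)
  left_inv _ := rfl
  right_inv _ := rfl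

/-- The theta series of `ℤ[i]` with the harmonic polynomial `α⁴` is a Rankin–Cohen bracket of
`θ₃` with itself, hence a multiple of `f₁`. -/
theorem hasSum_gaussian (τ : ℍ) :
    HasSum (fun α : GaussianInt => GaussianInt.toComplex α ^ 4 *
      nome τ ^ (α.re.natAbs ^ 2 + α.im.natAbs ^ 2)) (4 * LambdaForms.f₁ τ) := by
  rw [← gaussianPair.hasSum_iff]
  have m (k : ℕ) := hasSum_thetaMoment k τ
  have h := (((((m 4).prod_mul (m 0)).add (((m 3).prod_mul (m 1)).mul_left (4 * I))).add
    (((m 2).prod_mul (m 2)).mul_left (-6))).add (((m 1).prod_mul (m 3)).mul_left (-4 * I))).add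
    ((m 0).prod_mul (m 4))
  have hval : 2 * thetaMoment 0 τ * thetaMoment 4 τ - 6 * thetaMoment 2 τ ^ 2 =
      4 * LambdaForms.f₁ τ := by
    have hA := (((HasQExp.C 2).mul hasQExp_thetaMoment_zero).mul hasQExp_thetaMoment_four).sub
      ((HasQExp.C 6).mul (hasQExp_thetaMoment_two.pow 2))
    have hB := (HasQExp.C 4).mul hasQExp_f₁
    have hAB := isLandenTriple_theta.rankinCohen_phi
    have h1 := hA τ
    simp only [map_ofNat] at h1 hB
    rw [hAB] at h1
    exact h1.unique (hB τ)
  rw [← hval]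
  convert h.congr_fun fun p => ?_ using 1
  · rw [thetaMoment_odd (k := 1) (by decide), thetaMoment_odd (k := 3) (by decide)]
    ring
  · simp only [Function.comp_apply, gaussianPair, Equiv.coe_fn_mk, GaussianInt.toComplex_def,
      pow_add]
    have hI : I ^ 2 = -1 := I_sq
    have hI3 : I ^ 3 = -I := by rw [pow_succ, hI]; ring
    have hI4 : I ^ 4 = 1 := I_pow_four
    ring_nf
    rw [hI, hI3, hI4]
    ring

/-- Summing over ideals instead of generators: each nonzero ideal has four generators. -/
theorem hasSum_heckeChar (τ : ℍ) :
    HasSum (fun J : Ideal GaussianInt => heckeChar J * nome τ ^ Nat.card (GaussianInt ⧸ J))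
      (LambdaForms.f₁ τ) := by
  have h := (Equiv.sigmaFiberEquiv fun α : GaussianInt => Ideal.span {α}).hasSum_iff.mpr
    (hasSum_gaussian τ)
  have h1 : HasSum (fun J : Ideal GaussianInt =>
      4 * (heckeChar J * nome τ ^ Nat.card (GaussianInt ⧸ J))) (4 * LambdaForms.f₁ τ) := by
    refine h.sigma fun J => ?_
    have hc (α : {α : GaussianInt // Ideal.span {α} = J}) :
        GaussianInt.toComplex α ^ 4 * nome τ ^ (α.1.re.natAbs ^ 2 + α.1.im.natAbs ^ 2) =
        heckeChar J * nome τ ^ Nat.card (GaussianInt ⧸ J) := by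
      rw [← heckeChar_span, ← card_quotient_span, α.2]
    have hs : Summable fun α : {α : GaussianInt // Ideal.span {α} = J} =>
        heckeChar J * nome τ ^ Nat.card (GaussianInt ⧸ J) :=
      ((hasSum_gaussian τ).summable.comp_injective Subtype.val_injective).congr fun α => hc α
    have h2 := hs.hasSum
    rw [tsum_const] at h2
    have h3 : Nat.card {α : GaussianInt // Ideal.span {α} = J} •
        (heckeChar J * nome τ ^ Nat.card (GaussianInt ⧸ J)) =
        4 * (heckeChar J * nome τ ^ Nat.card (GaussianInt ⧸ J)) := by
      rcases eq_or_ne J ⊥ with rfl | hJ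
      · have : heckeChar ⊥ = 0 := map_zero heckeChar
        rw [this]
        simp
      · rw [card_generators hJ, nsmul_eq_mul]
        norm_num
    rw [h3] at h2
    exact h2.congr_fun fun α => hc α
  exact (hasSum_mul_left_iff (by norm_num : (4 : ℂ) ≠ 0)).mp h1

theorem hasCMByQi_f₁ : HasCMByQi 5 LambdaForms.f₁ :=
  ⟨⊤, heckeChar, isHeckeCharacter_heckeChar, hasSum_heckeChar⟩

/-- A form `∑ ψ(𝔞) q^{N 𝔞}` is normalized: `(1)` is the only ideal of norm `1`. -/
theorem coeff_one_genSeries_ideals (ψ : Ideal GaussianInt →*₀ ℂ) :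
    coeff 1 (genSeries ψ fun J => Nat.card (GaussianInt ⧸ J)) = 1 := by
  have h1 (J : Ideal GaussianInt) : Nat.card (GaussianInt ⧸ J) = 1 ↔ J = ⊤ := by
    rw [← Submodule.cardQuot_apply, Submodule.cardQuot_eq_one_iff]
  rw [genSeries, coeff_mk, tsum_eq_single ⟨⊤, (h1 ⊤).mpr rfl⟩
    fun J hJ => (hJ (Subtype.ext ((h1 J.1).mp J.2))).elim]
  exact (congrArg ψ Ideal.one_eq_top.symm).trans (map_one ψ)

theorem eq_cuspFormF₁ (G : CuspForm (Delta : Subgroup (GL (Fin 2) ℝ)) 5) (hG : HasCMByQi 5 G) :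
    G = cuspFormF₁ := by
  obtain ⟨c, hc⟩ := exists_eq_smul_f₁ G
  obtain ⟨𝔪, ψ, -, hψ⟩ := hG
  have h1 := hasQExp_genSeries hψ
  have h2 := (HasQExp.C c).mul (hasQExp_genSeries hasSum_heckeChar)
  have h3 : (G : ℍ → ℂ) = (fun _ => c) * LambdaForms.f₁ := funext hc
  rw [h3] at h1
  have h4 := congrArg (coeff 1) (h1.unique h2)
  rw [coeff_C_mul, coeff_one_genSeries_ideals, coeff_one_genSeries_ideals, mul_one] at h4
  ext τ
  rw [hc, ← h4, one_mul]
  rfl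

theorem f₁Series_eq_genSeries : X * psiSeries ^ 4 * phiSeries ^ 2 * vSeries ^ 4 =
    genSeries heckeChar fun J => Nat.card (GaussianInt ⧸ J) :=
  hasQExp_f₁.unique (hasQExp_genSeries hasSum_heckeChar)

theorem coeff_f₁Series_split {p : ℕ} (hp : p.Prime) (hp2 : 2 < p) {x y : ℤ}
    (hxy : (p : ℤ) = x ^ 2 + y ^ 2) :
    coeff p (X * psiSeries ^ 4 * phiSeries ^ 2 * vSeries ^ 4) =
      2 * (x : ℂ) ^ 4 - 12 * x ^ 2 * y ^ 2 + 2 * y ^ 4 := by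
  have hne := span_ne_span_conj hp hp2 hxy
  have hiff := ideals_of_norm_eq_split hp hxy
  have hs : {J : Ideal GaussianInt | Nat.card (GaussianInt ⧸ J) = p} =
      (({Ideal.span {⟨x, y⟩}, Ideal.span {⟨x, -y⟩}} : Finset (Ideal GaussianInt)) :
        Set (Ideal GaussianInt)) := by
    ext J
    simp [hiff J]
  rw [f₁Series_eq_genSeries, genSeries, coeff_mk]
  change ∑' J : {J : Ideal GaussianInt | Nat.card (GaussianInt ⧸ J) = p}, heckeChar J = _
  rw [hs, Finset.tsum_subtype' _ heckeChar, Finset.sum_pair hne, heckeChar_span, heckeChar_span,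
    GaussianInt.toComplex_def, GaussianInt.toComplex_def]
  push_cast
  linear_combination (12 * (x : ℂ) ^ 2 * y ^ 2 + 2 * y ^ 4 * (I ^ 2 - 1)) * I_sq

theorem coeff_f₁Series_inert {p : ℕ} (hp : p % 4 = 3) :
    coeff p (X * psiSeries ^ 4 * phiSeries ^ 2 * vSeries ^ 4) = 0 := by
  rw [f₁Series_eq_genSeries, genSeries, coeff_mk]
  have : IsEmpty {J : Ideal GaussianInt // Nat.card (GaussianInt ⧸ J) = p} :=
    ⟨fun J => no_ideal_of_norm_eq_inert hp J.1 J.2⟩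
  exact tsum_empty

end ComplexMultiplication

/-! ### Integrality of the expansions -/

section Integrality

open PowerSeries

/-- The power series with integral coefficients. -/
noncomputable def integralSeries : Subring ℂ⟦X⟧ := (PowerSeries.map (Int.castRingHom ℂ)).range

theorem mem_integralSeries {A : ℂ⟦X⟧} :
    A ∈ integralSeries ↔ ∃ a : ℕ → ℤ, ∀ n, (a n : ℂ) = coeff n A := by
  constructor
  · rintro ⟨B, rfl⟩
    exact ⟨fun n => coeff n B, fun n => by simp⟩
  · rintro ⟨a, ha⟩
    exact ⟨mk a, by ext n; simp [ha]⟩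

theorem X_mem_integralSeries : (X : ℂ⟦X⟧) ∈ integralSeries := ⟨X, map_X _⟩

theorem eulerD_mem_integralSeries {A : ℂ⟦X⟧} (hA : A ∈ integralSeries) :
    eulerD A ∈ integralSeries := by
  obtain ⟨a, ha⟩ := mem_integralSeries.mp hA
  exact mem_integralSeries.mpr ⟨fun n => n * a n, fun n => by
    rw [coeff_eulerD, ← ha]; push_cast; rfl⟩

theorem inv_mem_integralSeries {A : ℂ⟦X⟧} (hA : A ∈ integralSeries) (h1 : constantCoeff A = 1) :
    A⁻¹ ∈ integralSeries := by
  obtain ⟨B, rfl⟩ := hA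
  have hB : constantCoeff B = 1 := by
    rw [← coeff_zero_eq_constantCoeff_apply, coeff_map, coeff_zero_eq_constantCoeff_apply] at h1
    exact Int.cast_injective (α := ℂ) (by rw [Int.cast_one]; exact h1)
  obtain ⟨U, hU⟩ := (isUnit_iff_constantCoeff (φ := B)).mpr (by rw [hB]; exact isUnit_one)
  refine ⟨(U⁻¹ : ℤ⟦X⟧ˣ), ?_⟩
  rw [PowerSeries.eq_inv_iff_mul_eq_one (by rw [h1]; exact one_ne_zero), ← map_mul,
    ← hU, Units.inv_mul, map_one]

theorem genSeries_mem_integralSeries {ι : Type*} {c : ι → ℂ} {e : ι → ℕ}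
    (hc : ∀ i, c i ∈ (Int.castRingHom ℂ).range) (he : ∀ n, Finite {i // e i = n}) :
    genSeries c e ∈ integralSeries := by
  rw [mem_integralSeries]
  have (n : ℕ) : coeff n (genSeries c e) ∈ (Int.castRingHom ℂ).range := by
    have := Fintype.ofFinite {i // e i = n}
    rw [genSeries, coeff_mk, tsum_fintype]
    exact sum_mem fun i _ => hc i
  choose a ha using this
  exact ⟨a, ha⟩

theorem finite_natAbs_sq_eq (n : ℕ) : Finite {m : ℤ // m.natAbs ^ 2 = n} := by
  refine Set.Finite.to_subtype ((Set.finite_Icc (-n : ℤ) n).subset fun m hm => ?_)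
  have h1 : m.natAbs ^ 2 = n := hm
  have h2 : m.natAbs ≤ m.natAbs ^ 2 := Nat.le_self_pow two_ne_zero _
  rw [Set.mem_Icc]
  omega

theorem phiSeries_mem_integralSeries : phiSeries ∈ integralSeries :=
  genSeries_mem_integralSeries (fun _ => one_mem _) finite_natAbs_sq_eq

theorem vSeries_mem_integralSeries : vSeries ∈ integralSeries := by
  refine genSeries_mem_integralSeries (fun n => ?_) finite_natAbs_sq_eq
  rcases Int.even_or_odd n with h | h
  · rw [h.neg_one_zpow]; exact one_mem _
  · rw [h.neg_one_zpow]; exact neg_mem (one_mem _)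

theorem psiSeries_mem_integralSeries : psiSeries ∈ integralSeries := by
  refine genSeries_mem_integralSeries (fun _ => one_mem _) fun n => ?_
  exact Set.Finite.to_subtype ((Set.finite_Iic n).subset fun m hm => by
    have h1 : m ^ 2 + m = n := hm
    rw [Set.mem_Iic]
    omega)

/-- `θ₃ ≡ 1` modulo `2`. -/
theorem exists_phiSeries_eq : ∃ A ∈ integralSeries, phiSeries = 2 * A - 1 := by
  refine ⟨genSeries (fun _ : ℕ => 1) fun n => n ^ 2, ?_, ?_⟩
  · refine genSeries_mem_integralSeries (fun _ => one_mem _) fun n => ?_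
    exact Set.Finite.to_subtype ((Set.finite_Iic n).subset fun m hm => by
      have h1 : m ^ 2 = n := hm
      have h2 : m ≤ m ^ 2 := Nat.le_self_pow two_ne_zero _
      rw [Set.mem_Iic]
      omega)
  · have h1 : HasQExp (fun τ => (thetaThree τ + 1) / 2)
        (genSeries (fun _ : ℕ => 1) fun n => n ^ 2) := by
      refine hasQExp_genSeries fun τ => ?_
      have h := ((hasSum_thetaThree τ).nat_add_neg).mul_left (1 / 2)
      have e : (thetaThree τ + 1) / 2 = 1 / 2 * (thetaThree τ + nome τ ^ ((0 : ℤ) ^ 2)) := by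
        rw [zero_pow two_ne_zero, zpow_zero]
        ring
      rw [e]
      refine h.congr_fun fun n => ?_
      have e1 : nome τ ^ ((n : ℤ) ^ 2) = nome τ ^ n ^ 2 := by
        rw [← zpow_natCast]
        push_cast
        rfl
      rw [neg_sq, e1]
      ring
    have h2 := ((HasQExp.C 2).mul h1).sub HasQExp.one
    rw [map_ofNat] at h2
    refine hasQExp_thetaThree.unique ?_
    convert h2 using 1
    ext τ
    simp only [Pi.sub_apply, Pi.mul_apply, Pi.one_apply]
    ring

theorem HasQExp.hasFourierExpansion {F : ℍ → ℂ} {A : ℂ⟦X⟧} (h : HasQExp F A) {a : ℕ → ℤ}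
    (ha : ∀ n, (a n : ℂ) = coeff n A) : HasFourierExpansion F a := fun τ =>
  (h τ).congr_fun fun n => by rw [ha]

/-! ### The congruence between `f₁` and `g₁` -/

theorem hasQExp_g₁ :
    HasQExp LambdaForms.g₁ (X ^ 2 * psiSeries ^ 8 * vSeries ^ 8 * phiSeries⁻¹ ^ 6) := by
  have hinv := hasQExp_thetaThree.inv mdifferentiable_thetaThree thetaThree_ne_zero
    (by rw [isLandenTriple_theta.const_phi]; exact one_ne_zero)
  have := (((HasQExp.X.pow 2).mul (hasQExp_thetaTwoAux.pow 8)).mul (hasQExp_thetaFour.pow 8)).mul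
    (hinv.pow 6)
  convert this using 1
  ext τ
  have h3 := thetaThree_ne_zero τ
  simp only [Pi.mul_apply, Pi.pow_apply, Pi.inv_apply]
  rw [LambdaForms.g₁, one_sub_ell, ell_eq, theta]
  field_simp

/-- Comparing the coefficients of `qⁿ` in `D⁴ (θ₃ ^ (-6)) = -12 f₁ + 1296 g₁`, where
`D (θ₃ ^ (-6))` is divisible by `12` because `D θ₃` is divisible by `2`. -/
theorem modEq_of_coeff {b c : ℕ → ℤ}
    (hb : ∀ n, (b n : ℂ) = coeff n (X * psiSeries ^ 4 * phiSeries ^ 2 * vSeries ^ 4))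
    (hc : ∀ n, (c n : ℂ) = coeff n (X ^ 2 * psiSeries ^ 8 * vSeries ^ 8 * phiSeries⁻¹ ^ 6))
    (n : ℕ) : b n ≡ 108 * c n [ZMOD (n : ℤ) ^ 3] := by
  have hφ := isLandenTriple_theta.const_phi
  obtain ⟨A, hA, hA2⟩ := exists_phiSeries_eq
  have hinv := inv_mem_integralSeries phiSeries_mem_integralSeries hφ
  obtain ⟨k, hk⟩ := mem_integralSeries.mp
    (mul_mem (eulerD_mem_integralSeries hA) (pow_mem hinv 7))
  have hD : eulerD (phiSeries⁻¹ ^ 6) = -12 * (eulerD A * phiSeries⁻¹ ^ 7) := by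
    have h2 : eulerD (2 : ℂ⟦X⟧) = 0 := by simpa using (eulerD (K := ℂ)).map_natCast (n := 2)
    have h3 : eulerD phiSeries = 2 * eulerD A := by
      rw [hA2, map_sub, Derivation.leibniz, Derivation.map_one_eq_zero, h2]
      simp
    rw [isLandenTriple_theta.eulerD_inv_phi_pow, logD, h3]
    ring
  have h4 := congrArg (coeff n) isLandenTriple_theta.eulerD_four_inv_phi_pow
  have h12 : (-12 : ℂ⟦X⟧) = C (-12) := by rw [map_neg, map_ofNat]
  have h1296 : (1296 : ℂ⟦X⟧) = C 1296 := by rw [map_ofNat]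
  rw [hD, map_add, h12, h1296, coeff_eulerD, coeff_eulerD, coeff_eulerD, coeff_C_mul, coeff_C_mul,
    coeff_C_mul, ← hk, ← hb, ← hc] at h4
  have h5 : (108 * c n - b n : ℤ) = (n : ℤ) ^ 3 * -k n := by
    have : ((108 * c n - b n : ℤ) : ℂ) = (((n : ℤ) ^ 3 * -k n : ℤ) : ℂ) := by
      push_cast
      linear_combination -(1 / 12 : ℂ) * h4
    exact_mod_cast this
  exact (Int.modEq_iff_dvd).mpr ⟨_, h5⟩

/-! ### Vanishing coefficients -/

theorem coeff_X_pow_mul_dbl {k n : ℕ} (h : ¬ 2 ∣ n + k) (A : ℂ⟦X⟧) :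
    coeff n (X ^ k * dbl A) = 0 := by
  rw [coeff_X_pow_mul']
  split_ifs with hk
  · exact coeff_expand_of_not_dvd 2 two_ne_zero _ (by omega)
  · rfl

theorem coeff_X_pow_mul_dbl_dbl {k n : ℕ} (h : n % 4 ≠ k % 4) (A : ℂ⟦X⟧) :
    coeff n (X ^ k * dbl (dbl A)) = 0 := by
  rw [coeff_X_pow_mul']
  split_ifs with hk
  · rw [coeff_expand]
    split_ifs with h2
    · exact coeff_expand_of_not_dvd 2 two_ne_zero _ (by omega)
    · rfl
  · rfl

/-- In the expansion of `f_{2j+1}`, the identity `θ₄² = θ₃(2τ)² - θ₂(2τ)²` separates a part whose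
exponents are congruent to `1` modulo `4` from a part with even exponents. -/
theorem coeff_fSeq_odd_eq_zero {m : ℕ} (hm : m % 4 = 3) (j : ℕ) :
    coeff m (X ^ (4 * j + 1) * psiSeries ^ (16 * j + 4) * phiSeries ^ (4 * j + 2) *
      vSeries ^ (4 * j + 4)) = 0 := by
  have h := isLandenTriple_theta
  have e : X ^ (4 * j + 1) * psiSeries ^ (16 * j + 4) * phiSeries ^ (4 * j + 2) *
      vSeries ^ (4 * j + 4) =
      X ^ (4 * j + 1) * dbl (dbl (vSeries ^ (16 * j + 8) * (phiSeries * psiSeries) ^ (4 * j + 1))) -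
      C 4 * (X ^ (4 * j + 2) * dbl ((phiSeries * psiSeries) ^ (8 * j + 2) * vSeries ^ (8 * j + 4) *
        psiSeries ^ 2)) := by
    have e1 : psiSeries ^ (16 * j + 4) = dbl ((phiSeries * psiSeries) ^ (8 * j + 2)) := by
      rw [map_pow, map_mul, ← h.psi_sq]; ring
    have e2 : phiSeries ^ (4 * j + 2) * vSeries ^ (4 * j + 4) =
        dbl (vSeries ^ (8 * j + 4)) * vSeries ^ 2 := by
      rw [show vSeries ^ (4 * j + 4) = vSeries ^ (4 * j + 2) * vSeries ^ 2 by ring, ← mul_assoc,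
        ← mul_pow, h.phi_mul_v, map_pow]
      ring
    have e3 : dbl (vSeries ^ (16 * j + 8) * (phiSeries * psiSeries) ^ (4 * j + 1)) =
        (phiSeries * psiSeries) ^ (8 * j + 2) * vSeries ^ (8 * j + 4) * phiSeries ^ 2 := by
      rw [map_mul, map_pow, map_pow, map_mul, ← h.psi_sq,
        show dbl vSeries ^ (16 * j + 8) = (dbl vSeries ^ 2) ^ (8 * j + 4) by ring, ← h.phi_mul_v]
      ring
    rw [e3, mul_assoc, e2, e1, h.v_sq, map_ofNat, map_mul, map_mul, map_mul, map_mul,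
      map_pow dbl phiSeries 2, map_pow dbl psiSeries 2]
    ring
  rw [e, map_sub, coeff_C_mul, coeff_X_pow_mul_dbl_dbl (by omega), coeff_X_pow_mul_dbl (by omega)]
  ring

/-- In the expansion of `f_{2j+2}`, the identity `θ₃² = θ₃(2τ)² + θ₂(2τ)²` separates a part whose
exponents are congruent to `3` modulo `4` from a part with even exponents. -/
theorem coeff_fSeq_even_eq_zero {m : ℕ} (hm : m % 4 = 1) (j : ℕ) :
    coeff m (X ^ (4 * j + 3) * psiSeries ^ (16 * j + 12) * phiSeries ^ (4 * j + 6) *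
      vSeries ^ (4 * j + 4)) = 0 := by
  have h := isLandenTriple_theta
  have e : X ^ (4 * j + 3) * psiSeries ^ (16 * j + 12) * phiSeries ^ (4 * j + 6) *
      vSeries ^ (4 * j + 4) =
      X ^ (4 * j + 3) *
        dbl (dbl (vSeries ^ (16 * j + 16) * (phiSeries * psiSeries) ^ (4 * j + 3))) +
      C 4 * (X ^ (4 * j + 4) * dbl ((phiSeries * psiSeries) ^ (8 * j + 6) * vSeries ^ (8 * j + 8) *
        psiSeries ^ 2)) := by
    have e1 : psiSeries ^ (16 * j + 12) = dbl ((phiSeries * psiSeries) ^ (8 * j + 6)) := by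
      rw [map_pow, map_mul, ← h.psi_sq]; ring
    have e2 : phiSeries ^ (4 * j + 6) * vSeries ^ (4 * j + 4) =
        dbl (vSeries ^ (8 * j + 8)) * phiSeries ^ 2 := by
      rw [show phiSeries ^ (4 * j + 6) = phiSeries ^ 2 * phiSeries ^ (4 * j + 4) by ring, mul_assoc,
        ← mul_pow, h.phi_mul_v, map_pow]
      ring
    have e3 : dbl (vSeries ^ (16 * j + 16) * (phiSeries * psiSeries) ^ (4 * j + 3)) =
        (phiSeries * psiSeries) ^ (8 * j + 6) * vSeries ^ (8 * j + 8) * phiSeries ^ 2 := by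
      rw [map_mul, map_pow, map_pow, map_mul, ← h.psi_sq,
        show dbl vSeries ^ (16 * j + 16) = (dbl vSeries ^ 2) ^ (8 * j + 8) by ring, ← h.phi_mul_v]
      ring
    rw [e3, mul_assoc, e2, e1, map_ofNat, map_mul, map_mul, map_mul, map_mul,
      map_pow dbl phiSeries 2, map_pow dbl psiSeries 2, h.phi_sq]
    ring
  rw [e, map_add, coeff_C_mul, coeff_X_pow_mul_dbl_dbl (by omega), coeff_X_pow_mul_dbl (by omega)]
  ring

theorem fSeq_eq (m : ℕ) (τ : ℍ) : fSeq (m + 1) τ =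
    theta τ ^ (6 * m) * (1 - 16 * ell τ) ^ (m / 2) * ell τ ^ (2 * m) * LambdaForms.f₁ τ := by
  rw [fSeq, show 6 * (m + 1) - 6 = 6 * m by omega, show 2 * (m + 1) - 2 = 2 * m by omega,
    Nat.add_sub_cancel]

theorem hasQExp_fSeq_odd (j : ℕ) : HasQExp (fSeq (2 * j + 1)) (X ^ (4 * j + 1) *
    psiSeries ^ (16 * j + 4) * phiSeries ^ (4 * j + 2) * vSeries ^ (4 * j + 4)) := by
  have := (((HasQExp.X.pow (4 * j + 1)).mul (hasQExp_thetaTwoAux.pow (16 * j + 4))).mul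
    (hasQExp_thetaThree.pow (4 * j + 2))).mul (hasQExp_thetaFour.pow (4 * j + 4))
  convert this using 1
  ext τ
  have h3 := thetaThree_ne_zero τ
  simp only [Pi.mul_apply, Pi.pow_apply]
  rw [fSeq_eq, one_sub_ell, ell_eq, f₁_eq_theta, theta, show 2 * j / 2 = j by omega]
  generalize thetaTwoAux τ / 2 = s
  simp only [div_pow]
  field_simp
  ring

theorem hasQExp_fSeq_even (j : ℕ) : HasQExp (fSeq (2 * j + 2)) (X ^ (4 * j + 3) *
    psiSeries ^ (16 * j + 12) * phiSeries ^ (4 * j + 6) * vSeries ^ (4 * j + 4)) := by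
  have := (((HasQExp.X.pow (4 * j + 3)).mul (hasQExp_thetaTwoAux.pow (16 * j + 12))).mul
    (hasQExp_thetaThree.pow (4 * j + 6))).mul (hasQExp_thetaFour.pow (4 * j + 4))
  convert this using 1
  ext τ
  have h3 := thetaThree_ne_zero τ
  simp only [Pi.mul_apply, Pi.pow_apply]
  rw [fSeq_eq, one_sub_ell, ell_eq, f₁_eq_theta, theta, show (2 * j + 1) / 2 = j by omega]
  generalize thetaTwoAux τ / 2 = s
  simp only [div_pow]
  field_simp
  ring

end Integrality

/-! ### The expansions of the forms `fₙ` -/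

section ThetaPowers

open PowerSeries

theorem exists_fSeq_expansion (n : ℕ) (hn : 1 < n) : ∃ a : ℕ → ℤ, a 0 = 0 ∧
    HasFourierExpansion (fSeq n) a ∧ ∀ m : ℕ, (m : ℤ) ≡ (-1) ^ n [ZMOD 4] → a m = 0 := by
  have hφ := phiSeries_mem_integralSeries
  have hv := vSeries_mem_integralSeries
  have hψ := psiSeries_mem_integralSeries
  have hX := X_mem_integralSeries
  have hint (i j k l : ℕ) : X ^ i * psiSeries ^ j * phiSeries ^ k * vSeries ^ l ∈ integralSeries :=
    mul_mem (mul_mem (mul_mem (pow_mem hX i) (pow_mem hψ j)) (pow_mem hφ k)) (pow_mem hv l)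
  obtain ⟨j, rfl | rfl⟩ : ∃ j, n = 2 * j + 1 ∨ n = 2 * j + 2 := ⟨(n - 1) / 2, by omega⟩
  · obtain ⟨a, ha⟩ := mem_integralSeries.mp (hint (4 * j + 1) (16 * j + 4) (4 * j + 2) (4 * j + 4))
    refine ⟨a, ?_, (hasQExp_fSeq_odd j).hasFourierExpansion ha, fun m hm => ?_⟩
    · have := ha 0
      rw [coeff_zero_eq_constantCoeff_apply] at this
      simpa using this
    · rw [Odd.neg_one_pow ⟨j, rfl⟩, Int.ModEq] at hm
      have := ha m
      rw [coeff_fSeq_odd_eq_zero (by omega)] at this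
      exact_mod_cast this
  · obtain ⟨a, ha⟩ := mem_integralSeries.mp (hint (4 * j + 3) (16 * j + 12) (4 * j + 6) (4 * j + 4))
    refine ⟨a, ?_, (hasQExp_fSeq_even j).hasFourierExpansion ha, fun m hm => ?_⟩
    · have := ha 0
      rw [coeff_zero_eq_constantCoeff_apply] at this
      simpa using this
    · rw [Even.neg_one_pow ⟨j + 1, by ring⟩, Int.ModEq] at hm
      have := ha m
      rw [coeff_fSeq_even_eq_zero (by omega)] at this
      exact_mod_cast this

end ThetaPowers

theorem theorem2 :
    ∃ (b : ℕ → ℕ → ℤ) (c : ℕ → ℤ),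
      -- the Fourier expansions of `f₁`, of `fₙ` for `n > 1`, and of `g₁`
      (b 1 0 = 0 ∧ HasFourierExpansion LambdaForms.f₁ (b 1)) ∧
      (∀ n : ℕ, 1 < n → b n 0 = 0 ∧ HasFourierExpansion (LambdaForms.fSeq n) (b n)) ∧
      (c 0 = 0 ∧ c 1 = 0 ∧ HasFourierExpansion LambdaForms.g₁ c) ∧
      -- (a) `f₁` is the cusp form in `S₅(Δ)` with complex multiplication by `ℚ(i)`
      (∃ F : CuspForm (Delta : Subgroup (GL (Fin 2) ℝ)) 5,
        (F : ℍ → ℂ) = LambdaForms.f₁ ∧ HasCMByQi 5 F ∧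
        ∀ G : CuspForm (Delta : Subgroup (GL (Fin 2) ℝ)) 5, HasCMByQi 5 G → G = F) ∧
      (∀ p : ℕ, p.Prime → 2 < p →
        (p % 4 = 1 → ∀ x y : ℤ, (p : ℤ) = x ^ 2 + y ^ 2 →
          b 1 p = 2 * x ^ 4 - 12 * x ^ 2 * y ^ 2 + 2 * y ^ 4) ∧
        (p % 4 = 3 → b 1 p = 0)) ∧
      -- (b)
      IsWeaklyHolomorphic Delta 5 LambdaForms.g₁ ∧
      (∀ n : ℕ, 2 < n → b 1 n ≡ 108 * c n [ZMOD (n : ℤ) ^ 3]) ∧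
      -- (c)
      (∀ n : ℕ, 1 < n → ∀ p : ℕ, p.Prime → (p : ℤ) ≡ (-1) ^ n [ZMOD 4] → b n p = 0) := by
  have hφ := phiSeries_mem_integralSeries
  have hv := vSeries_mem_integralSeries
  have hψ := psiSeries_mem_integralSeries
  have hX := X_mem_integralSeries
  have hinv := inv_mem_integralSeries hφ isLandenTriple_theta.const_phi
  obtain ⟨b, hb⟩ := mem_integralSeries.mp
    (mul_mem (mul_mem (mul_mem hX (pow_mem hψ 4)) (pow_mem hφ 2)) (pow_mem hv 4))
  obtain ⟨c, hc⟩ := mem_integralSeries.mp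
    (mul_mem (mul_mem (mul_mem (pow_mem hX 2) (pow_mem hψ 8)) (pow_mem hv 8)) (pow_mem hinv 6))
  choose a ha0 ha hap using exists_fSeq_expansion
  have hX1 : PowerSeries.coeff 1 (PowerSeries.X ^ 2 * psiSeries ^ 8 * vSeries ^ 8 *
      phiSeries⁻¹ ^ 6) = 0 := by
    rw [mul_assoc, mul_assoc, PowerSeries.coeff_X_pow_mul']
    rfl
  refine ⟨fun n => if h : 1 < n then a n h else b, c, ⟨?_, ?_⟩, fun n hn => ?_, ⟨?_, ?_, ?_⟩,
    ⟨cuspFormF₁, rfl, hasCMByQi_f₁, eq_cuspFormF₁⟩,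
    fun p hp hp2 => ⟨fun _ x y hxy => ?_, fun h3 => ?_⟩,
    isWeaklyHolomorphic_g₁, fun n _ => ?_, fun n hn p _ hpn => ?_⟩
  · have := hb 0
    rw [PowerSeries.coeff_zero_eq_constantCoeff_apply] at this
    simpa using this
  · exact hasQExp_f₁.hasFourierExpansion hb
  · simp only [hn, dite_true]
    exact ⟨ha0 n hn, ha n hn⟩
  · have := hc 0
    rw [PowerSeries.coeff_zero_eq_constantCoeff_apply] at this
    simpa using this
  · exact_mod_cast (hc 1).trans hX1
  · exact hasQExp_g₁.hasFourierExpansion hc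
  · have := (hb p).trans (coeff_f₁Series_split hp hp2 hxy)
    exact_mod_cast this
  · have := (hb p).trans (coeff_f₁Series_inert h3)
    exact_mod_cast this
  · exact modEq_of_coeff hb hc n
  · simp only [hn, dite_true]
    exact hap n hn p hpn
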